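/- Let $n,\ell\ge 1$ be integers, and let $\mathfrak{sl}_n=\mathfrak n_+\oplus\mathfrak h\oplus\mathfrak n_-$ be the Lie algebra of traceless complex $n\times n$ matrices, where $\mathfrak h$ consists of the diagonal and $\mathfrak n_+$ (resp. $\mathfrak n_-$) of the strictly upper (resp. lower) triangular matrices. Let $V_n=\mathbb C^n$ be its vector representation, let $\rho\in\mathfrak h^*$ be half the sum of the positive roots $\varepsilon_i-\varepsilon_j$ ($i<j$), and let $h_i=E_{i,i}-E_{i+1,i+1}$ ($1\le i\le n-1$) be the simple coroots. Let $\mathcal O(\mathfrak{sl}_n)$ be the category whose objects are the $\mathfrak{sl}_n$-modules $X$ that are finitely generated over $U(\mathfrak{sl}_n)$, satisfy $\dim_{\mathbb C}U(\mathfrak n_+)v<\infty$ for every $v\in X$, and are the direct sum of their weight spaces $X_\mu=\{v\in X\mid hv=\mu(h)v\ \text{for all } h\in\mathfrak h\}$, $\mu\in\mathfrak h^*$; its morphisms are all $\mathfrak{sl}_n$-homomorphisms. For an $\mathfrak{sl}_n$-module $M$ let $H_0(\mathfrak n_-,M)=M/\mathfrak n_-M$ with its natural $\mathfrak h$-action,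 and for $\lambda\in\mathfrak h^*$ and $X\in\mathcal O(\mathfrak{sl}_n)$ put $$F_\lambda(X)=H_0\bigl(\mathfrak n_-,\,X\otimes V_n^{\otimes \ell}\bigr)_\lambda ,$$ the $\lambda$-weight space; a morphism $f$ is sent to the map induced by $f\otimes\mathrm{id}$. **Proposition.** Let $\lambda\in\mathfrak h^*$ be such that $\lambda+\rho$ is dominant integral, that is, $\langle\lambda+\rho,h_i\rangle\in\mathbb Z_{\ge 0}$ for $i=1,\dots,n-1$. Then $F_\lambda$ is an exact functor from $\mathcal O(\mathfrak{sl}_n)$ to the category of finite-dimensional complex vector spaces: every $F_\lambda(X)$ is finite-dimensional, $F_\lambda$ is additive, and for every short exact sequence $0\to X\to Y\to Z\to 0$ in $\mathcal O(\mathfrak{sl}_n)$ the sequence $0\to F_\lambda(X)\to F_\lambda(Y)\to F_\lambda(Z)\to 0$ is exact. -/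

import Mathlib

open CategoryTheory
open scoped TensorProduct

universe u

noncomputable section

namespace TypeA

attribute [local instance 100] LieRing.ofAssociativeRing

/-! ### The Lie algebra `sl_n`, its triangular decomposition and its weights -/

/-- The complex Lie algebra `sl_n` of traceless `n × n` matrices. -/
abbrev sl (n : ℕ) : LieSubalgebra ℂ (Matrix (Fin n) (Fin n) ℂ) :=
  LieAlgebra.SpecialLinear.sl (Fin n) ℂ

theorem sl_lie_apply {n : ℕ} (x y : sl n) (i j : Fin n) :
    (⁅x, y⁆ : sl n).val i j = ∑ k, x.val i k * y.val k j - ∑ k, y.val i k * x.val k j := by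
  rw [LieAlgebra.SpecialLinear.sl_bracket, Matrix.sub_apply, Matrix.mul_apply, Matrix.mul_apply]

/-- The Cartan subalgebra `h` of diagonal traceless matrices. -/
def cartan (n : ℕ) : LieSubalgebra ℂ (sl n) where
  carrier := {x | ∀ i j : Fin n, i ≠ j → x.val i j = 0}
  zero_mem' := fun _ _ _ => rfl
  add_mem' := fun {x y} hx hy i j hij => by
    simp [hx i j hij, hy i j hij]
  smul_mem' := fun c x hx i j hij => by
    simp [hx i j hij]
  lie_mem' := fun {x y} hx hy i j hij => by
    rw [sl_lie_apply]
    have h1 : ∀ k, x.val i k * y.val k j = 0 := fun k => by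
      by_cases h : i = k
      · rw [hy k j (by rw [← h]; exact hij), mul_zero]
      · rw [hx i k h, zero_mul]
    have h2 : ∀ k, y.val i k * x.val k j = 0 := fun k => by
      by_cases h : i = k
      · rw [hx k j (by rw [← h]; exact hij), mul_zero]
      · rw [hy i k h, zero_mul]
    simp [h1, h2]

/-- The nilpotent subalgebra `n_+` of strictly upper triangular matrices, that is, the sum of the
root spaces of the positive roots `ε_i - ε_j`, `i < j`. -/
def nPlus (n : ℕ) : LieSubalgebra ℂ (sl n) where
  carrier := {x | ∀ i j : Fin n, j ≤ i → x.val i j = 0}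
  zero_mem' := fun _ _ _ => rfl
  add_mem' := fun {x y} hx hy i j hij => by
    simp [hx i j hij, hy i j hij]
  smul_mem' := fun c x hx i j hij => by
    simp [hx i j hij]
  lie_mem' := fun {x y} hx hy i j hij => by
    rw [sl_lie_apply]
    have h1 : ∀ k, x.val i k * y.val k j = 0 := fun k => by
      rcases le_total k i with h | h
      · rw [hx i k h, zero_mul]
      · rw [hy k j (hij.trans h), mul_zero]
    have h2 : ∀ k, y.val i k * x.val k j = 0 := fun k => by
      rcases le_total k i with h | h
      · rw [hy i k h, zero_mul]
      · rw [hx k j (hij.trans h), mul_zero]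
    simp [h1, h2]

/-- The nilpotent subalgebra `n_-` of strictly lower triangular matrices, that is, the sum of the
root spaces of the negative roots. -/
def nMinus (n : ℕ) : LieSubalgebra ℂ (sl n) where
  carrier := {x | ∀ i j : Fin n, i ≤ j → x.val i j = 0}
  zero_mem' := fun _ _ _ => rfl
  add_mem' := fun {x y} hx hy i j hij => by
    simp [hx i j hij, hy i j hij]
  smul_mem' := fun c x hx i j hij => by
    simp [hx i j hij]
  lie_mem' := fun {x y} hx hy i j hij => by
    rw [sl_lie_apply]
    have h1 : ∀ k, x.val i k * y.val k j = 0 := fun k => by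
      rcases le_total i k with h | h
      · rw [hx i k h, zero_mul]
      · rw [hy k j (h.trans hij), mul_zero]
    have h2 : ∀ k, y.val i k * x.val k j = 0 := fun k => by
      rcases le_total i k with h | h
      · rw [hy i k h, zero_mul]
      · rw [hx k j (h.trans hij), mul_zero]
    simp [h1, h2]

/-- `[h, n_-] ⊆ n_-`. -/
theorem lie_cartan_nMinus_mem {n : ℕ} (h : cartan n) (y : nMinus n) :
    ⁅(h : sl n), (y : sl n)⁆ ∈ nMinus n := by
  intro i j hij
  rw [sl_lie_apply]
  have h1 : ∀ k, (h : sl n).val i k * (y : sl n).val k j = 0 := fun k => by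
    by_cases e : i = k
    · rw [y.2 k j (e ▸ hij), mul_zero]
    · rw [h.2 i k e, zero_mul]
  have h2 : ∀ k, (y : sl n).val i k * (h : sl n).val k j = 0 := fun k => by
    by_cases e : k = j
    · rw [y.2 i k (e ▸ hij), zero_mul]
    · rw [h.2 k j e, mul_zero]
  simp [h1, h2]

/-- The dual `h^*` of the Cartan subalgebra, whose elements are the weights of `sl_n`. -/
abbrev Weight (n : ℕ) : Type := Module.Dual ℂ (cartan n)

/-- The root `α_{ij} = ε_i - ε_j`. -/
def root {n : ℕ} (i j : Fin n) : Weight n where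
  toFun h := (h : sl n).val i i - (h : sl n).val j j
  map_add' h h' := by simp; ring
  map_smul' c h := by simp; ring

/-- The coroot `α_{ij}^∨ = E_{ii} - E_{jj}`. -/
def coroot {n : ℕ} (i j : Fin n) : cartan n :=
  ⟨⟨Matrix.single i i 1 - Matrix.single j j 1, by
      change Matrix.trace (Matrix.single i i (1 : ℂ) - Matrix.single j j 1) = 0
      simp⟩, fun a b hab => by
      have h1 : ¬ (i = a ∧ i = b) := fun h => hab (h.1.symm.trans h.2)
      have h2 : ¬ (j = a ∧ j = b) := fun h => hab (h.1.symm.trans h.2)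
      simp [h1, h2]⟩

/-- `ρ`, half the sum of the positive roots. -/
def rho (n : ℕ) : Weight n :=
  (1 / 2 : ℂ) • ∑ p : Fin n × Fin n with p.1 < p.2, root p.1 p.2

/-- `wt` is dominant integral: `⟨wt, h_i⟩` is a nonnegative integer for each simple coroot
`h_i = α_{i,i+1}^∨`. -/
def IsDominantIntegral {n : ℕ} (wt : Weight n) : Prop :=
  ∀ i j : Fin n, (i : ℕ) + 1 = j → ∃ m : ℕ, wt (coroot i j) = m

/-- The weight space `M_wt` of an `h`-module `M`. -/
def weightSpace {n : ℕ} (M : Type*) [AddCommGroup M] [Module ℂ M] [LieRingModule (cartan n) M]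
    [LieModule ℂ (cartan n) M] (wt : Weight n) : Submodule ℂ M where
  carrier := {v | ∀ h : cartan n, ⁅h, v⁆ = wt h • v}
  zero_mem' := fun h => by simp
  add_mem' := fun {v w} hv hw h => by rw [lie_add, hv h, hw h, smul_add]
  smul_mem' := fun c v hv h => by rw [lie_smul, hv h, smul_comm]

/-! ### The BGG category `O` -/

/-- The action of the universal enveloping algebra `U(L)` on an `L`-module `M`. -/
def envAction (L : Type*) [LieRing L] [LieAlgebra ℂ L] (M : Type*) [AddCommGroup M] [Module ℂ M]
    [LieRingModule L M] [LieModule ℂ L M] :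
    UniversalEnvelopingAlgebra ℂ L →ₐ[ℂ] Module.End ℂ M :=
  UniversalEnvelopingAlgebra.lift ℂ (LieModule.toEnd ℂ L M)

open Classical in
/-- The three conditions that define the category `O` among all `sl_n`-modules. -/
structure IsInO (n : ℕ) (X : Type u) [AddCommGroup X] [Module ℂ X] [LieRingModule (sl n) X]
    [LieModule ℂ (sl n) X] : Prop where
  /-- `X` is finitely generated over `U(sl_n)`. -/
  finitelyGenerated : ∃ S : Finset X,
    Submodule.span ℂ {x : X | ∃ a : UniversalEnvelopingAlgebra ℂ (sl n), ∃ s ∈ S,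
      envAction (sl n) X a s = x} = ⊤
  /-- `U(n_+) v` is finite-dimensional for each `v ∈ X`. -/
  locallyFinite : ∀ v : X, FiniteDimensional ℂ
    (LinearMap.range ((envAction (nPlus n) X).toLinearMap.flip v))
  /-- `X` is the direct sum of its weight spaces. -/
  weightDecomposition : DirectSum.IsInternal fun wt : Weight n => weightSpace X wt

/-- The objects of the BGG category `O(sl_n)`. -/
structure CategoryO (n : ℕ) : Type (u + 1) where
  carrier : Type u
  [addCommGroup : AddCommGroup carrier]
  [module : Module ℂ carrier]
  [lieRingModule : LieRingModule (sl n) carrier]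
  [lieModule : LieModule ℂ (sl n) carrier]
  isInO : IsInO n carrier

namespace CategoryO

variable {n : ℕ}

instance : CoeSort (CategoryO.{u} n) (Type u) := ⟨carrier⟩

instance (X : CategoryO.{u} n) : AddCommGroup X := X.addCommGroup
instance (X : CategoryO.{u} n) : Module ℂ X := X.module
instance (X : CategoryO.{u} n) : LieRingModule (sl n) X := X.lieRingModule
instance (X : CategoryO.{u} n) : LieModule ℂ (sl n) X := X.lieModule

/-- The morphisms of `O(sl_n)` are all the `sl_n`-homomorphisms. -/
instance : Category.{u} (CategoryO.{u} n) where
  Hom X Y := X →ₗ⁅ℂ, sl n⁆ Y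
  id _ := LieModuleHom.id
  comp f g := LieModuleHom.comp g f

/-- The `sl_n`-homomorphism underlying a morphism. -/
def toLie {X Y : CategoryO.{u} n} (f : X ⟶ Y) : X →ₗ⁅ℂ, sl n⁆ Y := f

instance (X Y : CategoryO.{u} n) : AddCommGroup (X ⟶ Y) :=
  inferInstanceAs (AddCommGroup (X →ₗ⁅ℂ, sl n⁆ Y))

instance : Preadditive (CategoryO.{u} n) where
  add_comp X Y Z f f' g := LieModuleHom.ext fun x => by
    change (toLie g) ((toLie f + toLie f') x) = (toLie g) (toLie f x) + (toLie g) (toLie f' x)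
    rw [LieModuleHom.add_apply, map_add]
  comp_add _ _ _ _ _ _ := rfl

end CategoryO

/-! ### Tensor powers of the vector representation -/

section TensorPower

variable {L V : Type*} [LieRing L] [LieAlgebra ℂ L] [AddCommGroup V] [Module ℂ V]
  [LieRingModule L V] [LieModule ℂ L V] {l : ℕ}

/-- The operator `1 ⊗ ⋯ ⊗ A ⊗ ⋯ ⊗ 1` on `V^{⊗ l}`, with `A` at the place `i`. -/
def atPlace (i : Fin l) (A : V →ₗ[ℂ] V) : Module.End ℂ (⨂[ℂ]^l V) :=
  PiTensorProduct.map (Function.update (fun _ : Fin l => (LinearMap.id : V →ₗ[ℂ] V)) i A)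

theorem atPlace_add (i : Fin l) (A B : V →ₗ[ℂ] V) :
    (atPlace i (A + B) : Module.End ℂ (⨂[ℂ]^l V)) = atPlace i A + atPlace i B :=
  PiTensorProduct.map_update_add (s := fun _ : Fin l => V) (t := fun _ : Fin l => V)
    (fun _ => LinearMap.id) i A B

theorem atPlace_smul (i : Fin l) (c : ℂ) (A : V →ₗ[ℂ] V) :
    (atPlace i (c • A) : Module.End ℂ (⨂[ℂ]^l V)) = c • atPlace i A :=
  PiTensorProduct.map_update_smul (s := fun _ : Fin l => V) (t := fun _ : Fin l => V)
    (fun _ => LinearMap.id) i c A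

theorem atPlace_comp (i : Fin l) (A B : V →ₗ[ℂ] V) :
    (atPlace i (A ∘ₗ B) : Module.End ℂ (⨂[ℂ]^l V)) = atPlace i A * atPlace i B := by
  unfold atPlace
  refine Eq.trans ?_ (PiTensorProduct.map_comp (s := fun _ : Fin l => V)
    (t := fun _ : Fin l => V) (t' := fun _ : Fin l => V) _ _)
  congr 1
  funext k
  by_cases h : k = i
  · subst h; simp
  · simp [h]

theorem atPlace_commute {i j : Fin l} (hij : i ≠ j) (A B : V →ₗ[ℂ] V) :
    (atPlace i A * atPlace j B : Module.End ℂ (⨂[ℂ]^l V)) = atPlace j B * atPlace i A := by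
  unfold atPlace
  refine ((PiTensorProduct.map_comp (s := fun _ : Fin l => V)
    (t := fun _ : Fin l => V) (t' := fun _ : Fin l => V) _ _).symm.trans ?_).trans
    (PiTensorProduct.map_comp (s := fun _ : Fin l => V)
    (t := fun _ : Fin l => V) (t' := fun _ : Fin l => V) _ _)
  congr 1
  funext k
  by_cases h : k = i
  · subst h; simp [hij]
  · simp [h]

/-- The operator `∑ i, 1 ⊗ ⋯ ⊗ x ⊗ ⋯ ⊗ 1` by which `x ∈ L` acts on `V^{⊗ l}`. -/
def tensorPowerAction (x : L) : Module.End ℂ (⨂[ℂ]^l V) :=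
  ∑ i : Fin l, atPlace i (LieModule.toEnd ℂ L V x)

theorem tensorPowerAction_mul (x y : L) :
    (tensorPowerAction x * tensorPowerAction y : Module.End ℂ (⨂[ℂ]^l V)) =
      tensorPowerAction ⁅x, y⁆ + tensorPowerAction y * tensorPowerAction x := by
  have hxy : LieModule.toEnd ℂ L V x ∘ₗ LieModule.toEnd ℂ L V y =
      LieModule.toEnd ℂ L V ⁅x, y⁆ + LieModule.toEnd ℂ L V y ∘ₗ LieModule.toEnd ℂ L V x :=
    LinearMap.ext fun v => leibniz_lie x y v
  simp only [tensorPowerAction, Finset.sum_mul_sum]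
  rw [Finset.sum_comm (f := fun i j => atPlace i (LieModule.toEnd ℂ L V y) *
    atPlace j (LieModule.toEnd ℂ L V x)), ← Finset.sum_add_distrib]
  refine Finset.sum_congr rfl fun i _ => ?_
  rw [← Finset.add_sum_erase _ _ (Finset.mem_univ i),
    ← Finset.add_sum_erase (a := i) _ (fun j => atPlace j (LieModule.toEnd ℂ L V y) *
      atPlace i (LieModule.toEnd ℂ L V x)) (Finset.mem_univ i),
    ← atPlace_comp, ← atPlace_comp, hxy, atPlace_add, add_assoc]
  congr 2
  refine Finset.sum_congr rfl fun j hj => ?_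
  exact atPlace_commute (Finset.ne_of_mem_erase hj).symm _ _

instance : LieRingModule L (⨂[ℂ]^l V) where
  bracket x t := tensorPowerAction x t
  add_lie x y t := by
    have h : (tensorPowerAction (x + y) : Module.End ℂ (⨂[ℂ]^l V)) =
        tensorPowerAction x + tensorPowerAction y := by
      simp only [tensorPowerAction, map_add, atPlace_add, Finset.sum_add_distrib]
    rw [h]; rfl
  lie_add x := map_add (tensorPowerAction x)
  leibniz_lie x y t := LinearMap.congr_fun (tensorPowerAction_mul x y) t

instance : LieModule ℂ L (⨂[ℂ]^l V) where
  smul_lie c x t := by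
    have h : (tensorPowerAction (c • x) : Module.End ℂ (⨂[ℂ]^l V)) =
        c • tensorPowerAction x := by
      simp only [tensorPowerAction, map_smul, atPlace_smul, Finset.smul_sum]
    exact LinearMap.congr_fun h t
  lie_smul c x := map_smul (tensorPowerAction x) c

end TensorPower

/-- The `sl_n`-module `X ⊗ V_n^{⊗ l}`, where `V_n = ℂ^n` is the vector representation and a
matrix `x ∈ sl_n` acts on `V_n` by `v ↦ x *ᵥ v`. -/
abbrev tensorModule (n l : ℕ) (X : Type u) [AddCommGroup X] [Module ℂ X] : Type u :=
  X ⊗[ℂ] (⨂[ℂ]^l (Fin n → ℂ))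

/-! ### Zeroth `n_-`-homology and the functor `F_λ` -/

section Homology

variable {n : ℕ} {M N P : Type*}
  [AddCommGroup M] [Module ℂ M] [LieRingModule (sl n) M] [LieModule ℂ (sl n) M]
  [AddCommGroup N] [Module ℂ N] [LieRingModule (sl n) N] [LieModule ℂ (sl n) N]

/-- The subspace `n_- M` spanned by all `y m` with `y ∈ n_-` and `m ∈ M`; it is stable under `h`. -/
def nMinusMul (n : ℕ) (M : Type*) [AddCommGroup M] [Module ℂ M] [LieRingModule (sl n) M]
    [LieModule ℂ (sl n) M] : LieSubmodule ℂ (cartan n) M where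
  toSubmodule := Submodule.span ℂ {m : M | ∃ y : nMinus n, ∃ v : M, ⁅y, v⁆ = m}
  lie_mem := fun {h m} hm => by
    change m ∈ Submodule.span ℂ _ at hm
    change ⁅h, m⁆ ∈ Submodule.span ℂ _
    induction hm using Submodule.span_induction with
    | mem m hm =>
      obtain ⟨y, v, rfl⟩ := hm
      have e : ⁅h, ⁅y, v⁆⁆ = ⁅(⟨⁅(h : sl n), (y : sl n)⁆, lie_cartan_nMinus_mem h y⟩ : nMinus n), v⁆
          + ⁅y, ⁅h, v⁆⁆ := leibniz_lie (h : sl n) (y : sl n) v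
      rw [e]
      exact add_mem (Submodule.subset_span ⟨_, _, rfl⟩) (Submodule.subset_span ⟨_, _, rfl⟩)
    | zero => rw [lie_zero]; exact zero_mem _
    | add a b _ _ ha hb => rw [lie_add]; exact add_mem ha hb
    | smul c a _ ha => rw [lie_smul]; exact Submodule.smul_mem _ _ ha

/-- `H_0(n_-, M) = M / n_- M`, with its natural `h`-module structure. -/
abbrev H0 (n : ℕ) (M : Type*) [AddCommGroup M] [Module ℂ M] [LieRingModule (sl n) M]
    [LieModule ℂ (sl n) M] : Type _ :=
  M ⧸ nMinusMul n M

/-- The linear map `H_0(n_-, M) → H_0(n_-, N)` induced by an `sl_n`-homomorphism `M → N`. -/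
def H0map (f : M →ₗ⁅ℂ, sl n⁆ N) : H0 n M →ₗ[ℂ] H0 n N :=
  Submodule.mapQ (nMinusMul n M).toSubmodule (nMinusMul n N).toSubmodule (f : M →ₗ[ℂ] N) <| by
    refine Submodule.span_le.2 ?_
    rintro _ ⟨y, v, rfl⟩
    refine Submodule.subset_span ⟨y, f v, ?_⟩
    exact (LieModuleHom.map_lie f (y : sl n) v).symm

theorem H0map_mk (f : M →ₗ⁅ℂ, sl n⁆ N) (m : M) :
    H0map f (LieSubmodule.Quotient.mk m) = LieSubmodule.Quotient.mk (f m) := rfl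

theorem H0map_mem_weightSpace (f : M →ₗ⁅ℂ, sl n⁆ N) (wt : Weight n) :
    ∀ v ∈ weightSpace (H0 n M) wt, H0map f v ∈ weightSpace (H0 n N) wt := by
  intro v hv h
  rw [← map_smul, ← hv h]
  obtain ⟨m, rfl⟩ := LieSubmodule.Quotient.surjective_mk' _ v
  have e : f ⁅h, m⁆ = ⁅h, f m⁆ := LieModuleHom.map_lie f (h : sl n) m
  change LieSubmodule.Quotient.mk ⁅h, f m⁆ = LieSubmodule.Quotient.mk (f ⁅h, m⁆)
  rw [e]

/-- The map induced by an `sl_n`-homomorphism between the weight spaces of `H_0(n_-, ·)`. -/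
def H0weightMap (wt : Weight n) (f : M →ₗ⁅ℂ, sl n⁆ N) :
    weightSpace (H0 n M) wt →ₗ[ℂ] weightSpace (H0 n N) wt :=
  (H0map f).restrict (H0map_mem_weightSpace f wt)

end Homology

/-- `f ⊗ id : X ⊗ V_n^{⊗ l} → Y ⊗ V_n^{⊗ l}`. -/
def tensorMap {n : ℕ} (l : ℕ) {X Y : CategoryO.{u} n} (f : X ⟶ Y) :
    tensorModule n l X →ₗ⁅ℂ, sl n⁆ tensorModule n l Y :=
  TensorProduct.LieModule.map (CategoryO.toLie f) LieModuleHom.id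

theorem tensorMap_id {n : ℕ} (l : ℕ) (X : CategoryO.{u} n) (m : tensorModule n l X) :
    tensorMap l (𝟙 X) m = m :=
  LinearMap.congr_fun (TensorProduct.map_id (R := ℂ) (M := X) (N := ⨂[ℂ]^l (Fin n → ℂ))) m

theorem tensorMap_comp {n : ℕ} (l : ℕ) {X Y Z : CategoryO.{u} n} (f : X ⟶ Y) (g : Y ⟶ Z)
    (m : tensorModule n l X) : tensorMap l (f ≫ g) m = tensorMap l g (tensorMap l f m) :=
  LinearMap.congr_fun (TensorProduct.map_comp (CategoryO.toLie g : Y →ₗ[ℂ] Z) LinearMap.id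
    (CategoryO.toLie f : X →ₗ[ℂ] Y) (LinearMap.id (M := ⨂[ℂ]^l (Fin n → ℂ)))) m

/-- The functor `F_wt : X ↦ H_0(n_-, X ⊗ V_n^{⊗ l})_wt` from `O(sl_n)` to complex vector
spaces. -/
def F (n l : ℕ) (wt : Weight n) : CategoryO.{u} n ⥤ ModuleCat.{u} ℂ where
  obj X := ModuleCat.of ℂ (weightSpace (H0 n (tensorModule n l X)) wt)
  map f := ModuleCat.ofHom (H0weightMap wt (tensorMap l f))
  map_id X := by
    apply ModuleCat.hom_ext
    apply LinearMap.ext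
    rintro ⟨v, hv⟩
    obtain ⟨m, rfl⟩ := LieSubmodule.Quotient.surjective_mk' _ v
    apply Subtype.ext
    change LieSubmodule.Quotient.mk (tensorMap l (𝟙 X) m) = LieSubmodule.Quotient.mk m
    rw [tensorMap_id]
  map_comp f g := by
    apply ModuleCat.hom_ext
    apply LinearMap.ext
    rintro ⟨v, hv⟩
    obtain ⟨m, rfl⟩ := LieSubmodule.Quotient.surjective_mk' _ v
    apply Subtype.ext
    change LieSubmodule.Quotient.mk (tensorMap l (f ≫ g) m) =
      LieSubmodule.Quotient.mk (tensorMap l g (tensorMap l f m))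
    rw [tensorMap_comp]

/-- `0 → X → Y → Z → 0` is a short exact sequence in `O(sl_n)`. -/
def IsShortExact {n : ℕ} {X Y Z : CategoryO.{u} n} (f : X ⟶ Y) (g : Y ⟶ Z) : Prop :=
  Function.Injective (CategoryO.toLie f) ∧
    Function.Exact (CategoryO.toLie f) (CategoryO.toLie g) ∧
      Function.Surjective (CategoryO.toLie g)

end TypeA

end

/-! Put `M = X ⊗ V_n^{⊗ l}`. Right exactness of `F_λ` is formal: tensoring over a field is exact,
coinvariants are right exact, and taking weight spaces is exact on modules spanned by weight
vectors. Dominance of `λ + ρ` is needed only to keep injections injective, and there the Casimir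
operator `C` does the work.

On highest weight vectors of weight `μ`, `C` acts by `c(μ) = ⟨μ, μ + 2ρ⟩` (`casimirScalar`). Let `T
= C - c(λ)` (`shiftedCasimir`), which commutes with `sl_n`. Moving raising operators to the right
shows that `T` maps `M_λ` into `(n_- M)_λ` (`casimir_of_mem_weightSpace`). Now let `μ = λ + β` with
`β` a nonzero sum of positive roots. Then `c(μ) - c(λ) = |β|² + 2⟨β, λ + ρ⟩` has positive real part.
A nonzero vector of `M_μ` killed by `T` could be raised to a highest weight vector still killed by
`T`, which is impossible. So `T` is injective on `M_μ`, hence bijective by finite-dimensionality.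
Since `(n_- M)_λ` is the span of the vectors `y v` with `y` a negative root vector and `v` in such
an `M_μ`, `T` is bijective on `(n_- M)_λ` as well.

Given an injection `f : M → N` and `m ∈ M_λ` with `f m ∈ n_- N`, choose `a ∈ (n_- M)_λ` with `T a =
T m`. Then `f (m - a)` lies in `(n_- N)_λ` and is killed by `T`, so it vanishes and `m = a ∈ n_- M`
(`mem_nMinusMul_of_map_mem`).

The finiteness used here, finite-dimensional weight spaces and heights bounded above, follows from
generation over `U(n_-)` by finitely many weight vectors (`IsNMinusFG`). This property holds in `O`
and survives tensoring with `V_n^{⊗ l}`. -/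

noncomputable section

namespace TypeA

attribute [local instance 100] LieRing.ofAssociativeRing

/-! ### Matrix units projected to `sl_n` -/

section UnitSl

variable {n : ℕ}

/-- The projection of the matrix unit `E_{ij}` to `sl_n` along the scalar matrices. -/
def unitSl (i j : Fin n) : sl n :=
  ⟨Matrix.single i j 1 - (if i = j then (1 / n : ℂ) else 0) • (1 : Matrix (Fin n) (Fin n) ℂ), by
    change Matrix.trace (Matrix.single i j (1 : ℂ) -
      (if i = j then (1 / n : ℂ) else 0) • (1 : Matrix (Fin n) (Fin n) ℂ)) = 0
    have hn : (n : ℂ) ≠ 0 := Nat.cast_ne_zero.2 (Nat.ne_of_gt i.pos)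
    rw [Matrix.trace_sub, Matrix.trace_smul, Matrix.trace_one]
    by_cases h : i = j
    · subst h; simp [hn]
    · simp [h, Matrix.trace_single_eq_of_ne _ _ _ h]⟩

theorem unitSl_val (i j : Fin n) : (unitSl i j).val = Matrix.single i j 1 -
    (if i = j then (1 / n : ℂ) else 0) • (1 : Matrix (Fin n) (Fin n) ℂ) := rfl

theorem unitSl_apply (i j a b : Fin n) : (unitSl i j).val a b =
    (if i = a ∧ j = b then 1 else 0) - (if i = j then (1 / n : ℂ) else 0) *
      (if a = b then 1 else 0) := by
  rw [unitSl_val, Matrix.sub_apply, Matrix.smul_apply, Matrix.single_apply, Matrix.one_apply,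
    smul_eq_mul]

/-- The scalar corrections add up to a multiple of the trace of `x`, which is zero. -/
theorem sum_smul_unitSl (x : sl n) : ∑ i, ∑ j, x.val i j • unitSl i j = x := by
  have htr : ∑ i, x.val i i = 0 := x.2
  apply Subtype.ext
  ext a b
  have : (∑ i, ∑ j, x.val i j • unitSl i j).val a b
      = ∑ i, ∑ j, x.val i j * (unitSl i j).val a b := by
    simp [Matrix.sum_apply]
  rw [this]
  simp only [unitSl_apply, mul_sub, Finset.sum_sub_distrib]
  have h1 : ∑ i, ∑ j, x.val i j * (if i = a ∧ j = b then (1 : ℂ) else 0) = x.val a b := by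
    rw [Finset.sum_eq_single a, Finset.sum_eq_single b] <;> simp +contextual
  have h2 : ∑ i, ∑ j, x.val i j * ((if i = j then (1 / n : ℂ) else 0) *
      (if a = b then 1 else 0)) = 0 := by
    have : ∀ i, ∑ j, x.val i j * ((if i = j then (1 / n : ℂ) else 0) *
        (if a = b then 1 else 0)) = x.val i i * ((1 / n : ℂ) * (if a = b then 1 else 0)) := by
      intro i
      rw [Finset.sum_eq_single i]
      · simp
      · intro j _ hj; simp [hj.symm]
      · simp
    rw [Finset.sum_congr rfl fun i _ => this i, ← Finset.sum_mul, htr, zero_mul]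
  rw [h1, h2, sub_zero]

/-- Scalar matrices drop out of the bracket, and on the right the corrections cancel, so the `gl_n`
relations persist. Diagonal and off-diagonal elements can thus be treated uniformly. -/
theorem unitSl_lie (a b c d : Fin n) : ⁅unitSl a b, unitSl c d⁆ =
    (if b = c then (1 : ℂ) else 0) • unitSl a d - (if d = a then (1 : ℂ) else 0) • unitSl c b := by
  apply Subtype.ext
  rw [LieAlgebra.SpecialLinear.sl_bracket]
  have e : ∀ (A B : Matrix (Fin n) (Fin n) ℂ) (s t : ℂ),
      (A - s • (1 : Matrix (Fin n) (Fin n) ℂ)) * (B - t • 1) - (B - t • 1) * (A - s • 1)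
        = A * B - B * A := by
    intro A B s t
    simp only [sub_mul, mul_sub, smul_mul_assoc, mul_smul_comm, one_mul, mul_one, smul_sub,
      smul_smul, mul_comm s t]
    abel
  change _ = (if b = c then (1 : ℂ) else 0) • (unitSl a d).val -
    (if d = a then (1 : ℂ) else 0) • (unitSl c b).val
  simp only [unitSl_val]
  rw [e]
  by_cases h1 : b = c <;> by_cases h2 : d = a
  · subst h1 h2; simp
  · subst h1
    rw [Matrix.single_mul_single_same, Matrix.single_mul_single_of_ne _ _ _ _ h2]
    simp [h2, Ne.symm h2]
  · subst h2
    rw [Matrix.single_mul_single_same, Matrix.single_mul_single_of_ne _ _ _ _ h1]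
    simp [h1, Ne.symm h1]
  · rw [Matrix.single_mul_single_of_ne _ _ _ _ h1, Matrix.single_mul_single_of_ne _ _ _ _ h2]
    simp [h1, h2]

theorem cartan_lie_unitSl (h : cartan n) (i j : Fin n) :
    ⁅(h : sl n), unitSl i j⁆ = root i j h • unitSl i j := by
  apply Subtype.ext
  rw [LieAlgebra.SpecialLinear.sl_bracket]
  ext a b
  have h0 : ∀ a b, a ≠ b → (h : sl n).val a b = 0 := h.2
  have hr : root i j h = (h : sl n).val i i - (h : sl n).val j j := rfl
  have e1 : ((h : sl n).val * (unitSl i j).val) a b = (h : sl n).val a a * (unitSl i j).val a b := by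
    rw [Matrix.mul_apply]
    exact Finset.sum_eq_single a (fun k _ hk => by rw [h0 a k hk.symm, zero_mul]) (by simp)
  have e2 : ((unitSl i j).val * (h : sl n).val) a b = (unitSl i j).val a b * (h : sl n).val b b := by
    rw [Matrix.mul_apply]
    exact Finset.sum_eq_single b (fun k _ hk => by rw [h0 k b hk, mul_zero]) (by simp)
  rw [Matrix.sub_apply, e1, e2]
  change _ = root i j h * (unitSl i j).val a b
  rw [hr]
  simp only [unitSl_apply]
  by_cases h1 : i = a ∧ j = b
  · obtain ⟨rfl, rfl⟩ := h1
    by_cases h2 : i = j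
    · subst h2; simp; ring
    · simp [h2]
  · by_cases h2 : i = j
    · subst h2
      by_cases h3 : a = b
      · subst h3; simp only [if_neg h1]; ring
      · simp [h3, h1]
    · simp [h1, h2]

theorem unitSl_self_mem_cartan (i : Fin n) : unitSl i i ∈ cartan n := by
  intro a b hab
  have : ¬ (i = a ∧ i = b) := fun h => hab (h.1.symm.trans h.2)
  rw [unitSl_apply]
  simp [hab, this]

/-- The diagonal element `E_{ii} - 1/n` of the Cartan subalgebra. -/
def diagSl (i : Fin n) : cartan n := ⟨unitSl i i, unitSl_self_mem_cartan i⟩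

theorem root_diagSl (i j k : Fin n) :
    root i j (diagSl k) = (if k = i then (1 : ℂ) else 0) - (if k = j then 1 else 0) := by
  change (unitSl k k).val i i - (unitSl k k).val j j = _
  simp [unitSl_apply]

theorem coroot_eq (i j : Fin n) : coroot i j = diagSl i - diagSl j := by
  apply Subtype.ext
  apply Subtype.ext
  change Matrix.single i i 1 - Matrix.single j j 1 = (unitSl i i).val - (unitSl j j).val
  simp [unitSl_val]

theorem unitSl_mem_nMinus {i j : Fin n} (hij : j < i) : unitSl i j ∈ nMinus n := by
  intro a b hab
  have : ¬ (i = a ∧ j = b) := by rintro ⟨rfl, rfl⟩; exact absurd hij (not_lt.2 hab)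
  rw [unitSl_apply]
  simp [this, hij.ne']

theorem unitSl_mem_nPlus {i j : Fin n} (hij : i < j) : unitSl i j ∈ nPlus n := by
  intro a b hab
  have : ¬ (i = a ∧ j = b) := by rintro ⟨rfl, rfl⟩; exact absurd hij (not_lt.2 hab)
  rw [unitSl_apply]
  simp [this, hij.ne]

end UnitSl

section Stability

variable {n : ℕ} {M : Type*} [AddCommGroup M] [Module ℂ M] [LieRingModule (sl n) M]
  [LieModule ℂ (sl n) M]

theorem lie_eq_sum_unitSl (x : sl n) (m : M) :
    ⁅x, m⁆ = ∑ i, ∑ j, x.val i j • ⁅unitSl i j, m⁆ := by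
  conv_lhs => rw [← sum_smul_unitSl x]
  simp only [sum_lie, smul_lie]

end Stability

/-- The endomorphisms preserving `P` form an associative subalgebra containing the image of `L`, so
the action of the enveloping algebra factors through it. -/
theorem envAction_mem {L : Type*} [LieRing L] [LieAlgebra ℂ L] {M : Type*} [AddCommGroup M]
    [Module ℂ M] [LieRingModule L M] [LieModule ℂ L M] {P : Submodule ℂ M}
    (hP : ∀ x : L, ∀ m ∈ P, ⁅x, m⁆ ∈ P) (a : UniversalEnvelopingAlgebra ℂ L) {m : M}
    (hm : m ∈ P) : envAction L M a m ∈ P := by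
  let A : Subalgebra ℂ (Module.End ℂ M) :=
    { carrier := {φ | ∀ m ∈ P, φ m ∈ P}
      mul_mem' := fun hf hg m hm => hf _ (hg m hm)
      add_mem' := fun hf hg m hm => P.add_mem (hf m hm) (hg m hm)
      algebraMap_mem' := fun c m hm => P.smul_mem c hm }
  let φ : L →ₗ⁅ℂ⁆ A :=
    { toFun := fun x => ⟨LieModule.toEnd ℂ L M x, hP x⟩
      map_add' := fun x y => Subtype.ext (map_add _ x y)
      map_smul' := fun c x => Subtype.ext (map_smul _ c x)
      map_lie' := fun {x y} => Subtype.ext (LieHom.map_lie (LieModule.toEnd ℂ L M) x y) }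
  have e : A.val.comp (UniversalEnvelopingAlgebra.lift ℂ φ) = envAction L M := by
    apply UniversalEnvelopingAlgebra.hom_ext
    ext x : 1
    simp [envAction, φ]
  rw [← e]
  exact (UniversalEnvelopingAlgebra.lift ℂ φ a).2 m hm

/-- Split `x` into a part in `A i` and a part in the sum of the other `B j`; independence kills the
second. This extracts the weight component of any subspace built from weight vectors. -/
theorem mem_of_mem_iSup_of_iSupIndep {ι R M : Type*} [Ring R] [AddCommGroup M] [Module R M]
    {A B : ι → Submodule R M} (hB : iSupIndep B) (hAB : ∀ i, A i ≤ B i) {i : ι} {x : M}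
    (hx : x ∈ ⨆ j, A j) (hxi : x ∈ B i) : x ∈ A i := by
  have h : ⨆ j, A j ≤ A i ⊔ ⨆ (j) (_ : j ≠ i), B j := by
    refine iSup_le fun j => ?_
    by_cases hj : j = i
    · subst hj; exact le_sup_left
    · exact (hAB j).trans
        ((le_iSup₂ (f := fun (k : ι) (_ : k ≠ i) => B k) j hj).trans le_sup_right)
  obtain ⟨a, ha, b, hb, rfl⟩ := Submodule.mem_sup.1 (h hx)
  have hbi : b ∈ B i := by simpa using (B i).sub_mem hxi (hAB i ha)
  have : b = 0 := Submodule.disjoint_def.1 (hB i) b hbi hb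
  rw [this, add_zero]; exact ha

/-! ### Weight spaces and heights -/

section WeightSpaces

variable {n : ℕ}

theorem cartan_lie_cartan (h h' : cartan n) : ⁅h, h'⁆ = 0 := by
  apply Subtype.ext
  apply Subtype.ext
  change (⁅(h : sl n), (h' : sl n)⁆ : sl n).val = 0
  ext i j
  rw [sl_lie_apply, Finset.sum_eq_single i, Finset.sum_eq_single i]
  · by_cases e : i = j
    · subst e; simp [mul_comm]
    · simp [h.2 i j e, h'.2 i j e]
  · intro k _ hk; rw [h'.2 i k hk.symm, zero_mul]
  · simp
  · intro k _ hk; rw [h.2 i k hk.symm, zero_mul]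
  · simp

instance : IsLieAbelian (cartan n) := ⟨cartan_lie_cartan⟩

theorem iSupIndep_weightSpace (M : Type*) [AddCommGroup M] [Module ℂ M]
    [LieRingModule (cartan n) M] [LieModule ℂ (cartan n) M] :
    iSupIndep fun wt : Weight n => weightSpace M wt := by
  have h1 := (LieSubmodule.iSupIndep_toSubmodule.2
    (LieModule.iSupIndep_genWeightSpace ℂ (cartan n) M)).comp
    (f := fun wt : Weight n => (wt : cartan n → ℂ)) DFunLike.coe_injective
  refine h1.mono fun wt m hm => ?_
  exact LieModule.weightSpace_le_genWeightSpace M _ ((LieModule.mem_weightSpace _ m).2 hm)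

variable {M : Type*} [AddCommGroup M] [Module ℂ M] [LieRingModule (sl n) M]
  [LieModule ℂ (sl n) M]

theorem unitSl_lie_mem_weightSpace {wt : Weight n} {v : M} (hv : v ∈ weightSpace M wt)
    (i j : Fin n) : ⁅unitSl i j, v⁆ ∈ weightSpace M (wt + root i j) := by
  intro h
  have hv' : ⁅(h : sl n), v⁆ = wt h • v := hv h
  change ⁅(h : sl n), ⁅unitSl i j, v⁆⁆ = _
  rw [leibniz_lie, cartan_lie_unitSl, smul_lie, hv', lie_smul, ← add_smul, LinearMap.add_apply,
    add_comm]

theorem unitSl_lie_mem_weightSpace' {wt wt' : Weight n} {v : M} (hv : v ∈ weightSpace M wt)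
    (i j : Fin n) (h : wt' = wt + root i j) : ⁅unitSl i j, v⁆ ∈ weightSpace M wt' :=
  h ▸ unitSl_lie_mem_weightSpace hv i j

/-- The height `-∑ k • wt_k` of a weight; the root `ε_i - ε_j` has height `j - i`. -/
def height : Weight n →+ ℝ where
  toFun wt := -∑ k : Fin n, (k : ℝ) * (wt (diagSl k)).re
  map_zero' := by simp
  map_add' a b := by simp [mul_add, Finset.sum_add_distrib]; ring

theorem height_root (i j : Fin n) : height (root i j) = (j : ℝ) - i := by
  have e : ∀ k : Fin n, (k : ℝ) * (root i j (diagSl k)).re =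
      (if k = i then (i : ℝ) else 0) - (if k = j then (j : ℝ) else 0) := by
    intro k
    rw [root_diagSl]
    by_cases h1 : k = i <;> by_cases h2 : k = j <;> simp_all
  change -∑ k : Fin n, (k : ℝ) * (root i j (diagSl k)).re = _
  simp only [e, Finset.sum_sub_distrib, Finset.sum_ite_eq', Finset.mem_univ, if_true]
  ring

theorem one_le_height_root {i j : Fin n} (h : i < j) : 1 ≤ height (root i j) := by
  rw [height_root]
  have : (i : ℝ) + 1 ≤ j := by exact_mod_cast h
  linarith

theorem height_root_le {i j : Fin n} (h : j < i) : height (root i j) ≤ -1 := by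
  rw [height_root]
  have : (j : ℝ) + 1 ≤ i := by exact_mod_cast h
  linarith

end WeightSpaces

/-! ### Finiteness of modules finitely generated over `U(n_-)` -/

/-- `M` is generated over `U(n_-)` by finitely many weight vectors. -/
def IsNMinusFG (n : ℕ) (M : Type*) [AddCommGroup M] [Module ℂ M] [LieRingModule (sl n) M]
    [LieModule ℂ (sl n) M] : Prop :=
  ∃ B : Set M, B.Finite ∧ (∀ b ∈ B, ∃ wt : Weight n, b ∈ weightSpace M wt) ∧
    ∀ P : Submodule ℂ M, B ⊆ P → (∀ i j : Fin n, j < i → ∀ m ∈ P, ⁅unitSl i j, m⁆ ∈ P) → P = ⊤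

section NMinusFG

variable {n : ℕ} {M : Type*} [AddCommGroup M] [Module ℂ M] [LieRingModule (sl n) M]
  [LieModule ℂ (sl n) M]

theorem iSup_weightSpace_stable (i j : Fin n) {m : M}
    (hm : m ∈ ⨆ wt : Weight n, weightSpace M wt) :
    ⁅unitSl i j, m⁆ ∈ ⨆ wt : Weight n, weightSpace M wt := by
  induction hm using Submodule.iSup_induction' with
  | mem wt x hx => exact Submodule.mem_iSup_of_mem _ (unitSl_lie_mem_weightSpace hx i j)
  | zero => rw [lie_zero]; exact zero_mem _
  | add x y _ _ hx hy => rw [lie_add]; exact add_mem hx hy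

theorem IsNMinusFG.iSup_weightSpace (hM : IsNMinusFG n M) :
    ⨆ wt : Weight n, weightSpace M wt = ⊤ := by
  obtain ⟨B, -, hB, hP⟩ := hM
  refine hP _ (fun b hb => ?_) fun i j _ m hm => iSup_weightSpace_stable i j hm
  obtain ⟨wt, h⟩ := hB b hb
  exact Submodule.mem_iSup_of_mem wt h

/-- The vectors obtained from `B` by applying `k` negative root vectors. -/
def descendants (B : Set M) : ℕ → Set M
  | 0 => B
  | k + 1 => {m | ∃ i j : Fin n, j < i ∧ ∃ v ∈ descendants B k, ⁅unitSl i j, v⁆ = m}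

omit [Module ℂ M] [LieModule ℂ (sl n) M] in
theorem finite_descendants {B : Set M} (hB : B.Finite) (k : ℕ) :
    (descendants (n := n) B k).Finite := by
  induction k with
  | zero => exact hB
  | succ k ih =>
    refine (Set.Finite.biUnion (Set.finite_univ (α := Fin n × Fin n)) fun p _ =>
      ih.image fun v => ⁅unitSl p.1 p.2, v⁆).subset ?_
    rintro _ ⟨i, j, -, v, hv, rfl⟩
    exact Set.mem_biUnion (Set.mem_univ (i, j)) ⟨v, hv, rfl⟩

/-- Each negative root vector lowers the height by at least one. With `R` bounding the heights of
the generators, a vector at depth `k` therefore has height at most `R - k`; both finiteness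
statements below follow. -/
theorem exists_weightSpace_le_span (hM : IsNMinusFG n M) :
    ∃ R : ℝ, ∃ D : ℕ → Set M, (∀ k, (D k).Finite) ∧
      ∀ wt : Weight n, weightSpace M wt ≤
        Submodule.span ℂ {x | ∃ k : ℕ, x ∈ D k ∧ height wt ≤ R - k} := by
  obtain ⟨B, hfin, hB, hP⟩ := hM
  choose! wtB hwtB using hB
  obtain ⟨R, hR⟩ := (hfin.image fun b => height (wtB b)).bddAbove
  have hB' : ∀ b ∈ B, ∃ wt : Weight n, b ∈ weightSpace M wt ∧ height wt ≤ R := fun b hb =>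
    ⟨wtB b, hwtB b hb, hR ⟨b, hb, rfl⟩⟩
  refine ⟨R, descendants (n := n) B, finite_descendants hfin, fun wt x hx => ?_⟩
  let A : Weight n → Submodule ℂ M := fun wt => Submodule.span ℂ
    {x | x ∈ weightSpace M wt ∧ ∃ k : ℕ, x ∈ descendants (n := n) B k ∧ height wt ≤ R - k}
  have hA : ⨆ wt, A wt = ⊤ := by
    refine hP _ (fun b hb => ?_) fun i j hij m hm => ?_
    · obtain ⟨wt, h1, h2⟩ := hB' b hb
      exact Submodule.mem_iSup_of_mem wt
        (Submodule.subset_span ⟨h1, 0, hb, by simpa using h2⟩)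
    · induction hm using Submodule.iSup_induction' with
      | mem wt x hx =>
        refine Submodule.mem_iSup_of_mem (wt + root i j) ?_
        change x ∈ Submodule.span ℂ _ at hx
        induction hx using Submodule.span_induction with
        | mem x hx =>
          obtain ⟨h1, k, h2, h3⟩ := hx
          refine Submodule.subset_span ⟨unitSl_lie_mem_weightSpace h1 i j, k + 1,
            ⟨i, j, hij, x, h2, rfl⟩, ?_⟩
          have := height_root_le hij
          rw [map_add]; push_cast; linarith
        | zero => rw [lie_zero]; exact zero_mem _
        | add a b _ _ ha hb => rw [lie_add]; exact add_mem ha hb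
        | smul c a _ ha => rw [lie_smul]; exact Submodule.smul_mem _ _ ha
      | zero => rw [lie_zero]; exact zero_mem _
      | add x y _ _ hx hy => rw [lie_add]; exact add_mem hx hy
  have hxA : x ∈ A wt := mem_of_mem_iSup_of_iSupIndep (A := A) (iSupIndep_weightSpace M)
    (fun wt => Submodule.span_le.2 fun y hy => hy.1) (by rw [hA]; exact Submodule.mem_top) hx
  exact Submodule.span_mono (fun y hy => hy.2) hxA

theorem IsNMinusFG.finiteDimensional_weightSpace (hM : IsNMinusFG n M) (wt : Weight n) :
    FiniteDimensional ℂ (weightSpace M wt) := by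
  obtain ⟨R, D, hD, h⟩ := exists_weightSpace_le_span hM
  -- Only the finitely many depths `k ≤ R - height wt` contribute.
  have hfin : {x | ∃ k : ℕ, x ∈ D k ∧ height wt ≤ R - k}.Finite := by
    refine ((Set.finite_Iic ⌊R - height wt⌋₊).biUnion fun k _ => hD k).subset ?_
    rintro x ⟨k, h1, h2⟩
    exact Set.mem_biUnion (Nat.le_floor (by linarith)) h1
  have := FiniteDimensional.span_of_finite ℂ hfin
  exact Submodule.finiteDimensional_of_le (h wt)

theorem IsNMinusFG.exists_height_bound (hM : IsNMinusFG n M) :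
    ∃ R : ℝ, ∀ wt : Weight n, R < height wt → weightSpace M wt = ⊥ := by
  obtain ⟨R, D, hD, h⟩ := exists_weightSpace_le_span hM
  refine ⟨R, fun wt hwt => ?_⟩
  have e : {x | ∃ k : ℕ, x ∈ D k ∧ height wt ≤ R - k} = ∅ := by
    ext x
    simp only [Set.mem_ofPred_eq, Set.mem_empty_iff_false, iff_false, not_exists, not_and, not_le]
    intro k _
    have : (0 : ℝ) ≤ k := Nat.cast_nonneg k
    linarith
  have := h wt
  rw [e, Submodule.span_empty] at this
  exact le_bot_iff.1 this

end NMinusFG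

/-! ### Objects of `O` are finitely generated over `U(n_-)` -/

section CategoryONMinusFG

variable {n : ℕ} {M : Type*} [AddCommGroup M] [Module ℂ M] [LieRingModule (sl n) M]
  [LieModule ℂ (sl n) M]

theorem mem_span_weightVectors (hM : ⨆ wt : Weight n, weightSpace M wt = ⊤) (v : M) :
    v ∈ Submodule.span ℂ {w : M | ∃ wt : Weight n, w ∈ weightSpace M wt} := by
  have hv : v ∈ ⨆ wt : Weight n, weightSpace M wt := hM ▸ Submodule.mem_top
  induction hv using Submodule.iSup_induction' with
  | mem wt x hx => exact Submodule.subset_span ⟨wt, hx⟩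
  | zero => exact zero_mem _
  | add x y _ _ hx hy => exact add_mem hx hy

/-- The span of the weight vectors in an `n_+`-stable subspace is `n_+`-stable. -/
theorem span_weightVectors_stable {P : Submodule ℂ M} (i j : Fin n)
    (hP : ∀ m ∈ P, ⁅unitSl i j, m⁆ ∈ P) {m : M}
    (hm : m ∈ Submodule.span ℂ {w : M | w ∈ P ∧ ∃ wt : Weight n, w ∈ weightSpace M wt}) :
    ⁅unitSl i j, m⁆ ∈
      Submodule.span ℂ {w : M | w ∈ P ∧ ∃ wt : Weight n, w ∈ weightSpace M wt} := by
  induction hm using Submodule.span_induction with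
  | mem w hw =>
    obtain ⟨h1, wt, h2⟩ := hw
    exact Submodule.subset_span ⟨hP w h1, _, unitSl_lie_mem_weightSpace h2 i j⟩
  | zero => rw [lie_zero]; exact zero_mem _
  | add a b _ _ ha hb => rw [lie_add]; exact add_mem ha hb
  | smul c a _ ha => rw [lie_smul]; exact Submodule.smul_mem _ _ ha

/-- Inside the finite-dimensional space `U(n_+) v`, the span of the weight vectors is still
`n_+`-stable and contains `v`; a finite spanning set of weight vectors serves as `B`. -/
theorem exists_finset_of_weightVector
    (hfin : ∀ v : M, FiniteDimensional ℂ
      (LinearMap.range ((envAction (nPlus n) M).toLinearMap.flip v)))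
    {v : M} {wt : Weight n} (hv : v ∈ weightSpace M wt) :
    ∃ B : Finset M, v ∈ Submodule.span ℂ (B : Set M) ∧
      (∀ b ∈ B, ∃ wt : Weight n, b ∈ weightSpace M wt) ∧
      ∀ i j : Fin n, i < j → ∀ m ∈ Submodule.span ℂ (B : Set M),
        ⁅unitSl i j, m⁆ ∈ Submodule.span ℂ (B : Set M) := by
  set W := LinearMap.range ((envAction (nPlus n) M).toLinearMap.flip v) with hW
  have hvW : v ∈ W := ⟨1, by simp⟩
  have hstab : ∀ i j : Fin n, i < j → ∀ m ∈ W, ⁅unitSl i j, m⁆ ∈ W := by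
    rintro i j hij _ ⟨a, rfl⟩
    refine ⟨UniversalEnvelopingAlgebra.ι ℂ (⟨unitSl i j, unitSl_mem_nPlus hij⟩ : nPlus n) * a, ?_⟩
    simp only [LinearMap.flip_apply, AlgHom.toLinearMap_apply, map_mul, Module.End.mul_apply]
    rw [envAction, UniversalEnvelopingAlgebra.lift_ι_apply]
    rfl
  set s : Set M := {w : M | w ∈ W ∧ ∃ wt : Weight n, w ∈ weightSpace M wt} with hs
  have hsW : Submodule.span ℂ s ≤ W := Submodule.span_le.2 fun w hw => hw.1
  have := hfin v
  have hfg : (Submodule.span ℂ s).FG := by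
    have : FiniteDimensional ℂ (Submodule.span ℂ s) := Submodule.finiteDimensional_of_le hsW
    exact Module.Finite.iff_fg.1 this
  obtain ⟨B, hB, hspan⟩ := (Submodule.fg_span_iff_fg_span_finset_subset s).1 hfg
  refine ⟨B, hspan ▸ Submodule.subset_span ⟨hvW, wt, hv⟩, fun b hb => (hB hb).2, ?_⟩
  rw [← hspan]
  exact fun i j hij m hm => span_weightVectors_stable i j (hstab i j hij) hm

theorem exists_finset_of_vector (hM : ⨆ wt : Weight n, weightSpace M wt = ⊤)
    (hfin : ∀ v : M, FiniteDimensional ℂ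
      (LinearMap.range ((envAction (nPlus n) M).toLinearMap.flip v))) (v : M) :
    ∃ B : Finset M, v ∈ Submodule.span ℂ (B : Set M) ∧
      (∀ b ∈ B, ∃ wt : Weight n, b ∈ weightSpace M wt) ∧
      ∀ i j : Fin n, i < j → ∀ m ∈ Submodule.span ℂ (B : Set M),
        ⁅unitSl i j, m⁆ ∈ Submodule.span ℂ (B : Set M) := by
  classical
  induction mem_span_weightVectors hM v using Submodule.span_induction with
  | mem v hv => exact exists_finset_of_weightVector hfin hv.choose_spec
  | zero => exact ⟨∅, by simp⟩
  | add x y _ _ hx hy =>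
    obtain ⟨B, h1, h2, h3⟩ := hx
    obtain ⟨C, k1, k2, k3⟩ := hy
    refine ⟨B ∪ C, ?_, ?_, ?_⟩
    · rw [Finset.coe_union, Submodule.span_union]
      exact add_mem (Submodule.mem_sup_left h1) (Submodule.mem_sup_right k1)
    · intro b hb
      rcases Finset.mem_union.1 hb with h | h
      exacts [h2 b h, k2 b h]
    · intro i j hij m hm
      rw [Finset.coe_union, Submodule.span_union] at hm ⊢
      obtain ⟨a, ha, b, hb, rfl⟩ := Submodule.mem_sup.1 hm
      rw [lie_add]
      exact add_mem (Submodule.mem_sup_left (h3 i j hij a ha))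
        (Submodule.mem_sup_right (k3 i j hij b hb))
  | smul c x _ hx =>
    obtain ⟨B, h1, h2⟩ := hx
    exact ⟨B, Submodule.smul_mem _ _ h1, h2⟩

/-- The smallest `n_-`-stable subspace containing `B`. -/
def nMinusClosure (n : ℕ) {M : Type*} [AddCommGroup M] [Module ℂ M] [LieRingModule (sl n) M]
    (B : Set M) : Submodule ℂ M :=
  sInf {P | B ⊆ P ∧ ∀ i j : Fin n, j < i → ∀ m ∈ P, ⁅unitSl i j, m⁆ ∈ P}

omit [LieModule ℂ (sl n) M] in
theorem nMinusClosure_stable (B : Set M) (i j : Fin n) (hij : j < i) (m : M)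
    (hm : m ∈ nMinusClosure n B) : ⁅unitSl i j, m⁆ ∈ nMinusClosure n B :=
  Submodule.mem_sInf.2 fun P hP => hP.2 i j hij m (Submodule.mem_sInf.1 hm P hP)

omit [LieModule ℂ (sl n) M] in
theorem span_le_nMinusClosure (B : Set M) : Submodule.span ℂ B ≤ nMinusClosure n B :=
  Submodule.span_le.2 fun _ hb => Submodule.mem_sInf.2 fun _ hP => hP.1 hb

omit [LieModule ℂ (sl n) M] in
theorem nMinusClosure_le {B : Set M} {P : Submodule ℂ M} (hB : B ⊆ P)
    (hP : ∀ i j : Fin n, j < i → ∀ m ∈ P, ⁅unitSl i j, m⁆ ∈ P) : nMinusClosure n B ≤ P :=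
  sInf_le ⟨hB, hP⟩

/-- The `n_-`-closure of an `n_+`-stable space spanned by weight vectors is `sl_n`-stable. -/
theorem lie_mem_nMinusClosure {B : Set M}
    (hB : ∀ b ∈ B, ∃ wt : Weight n, b ∈ weightSpace M wt)
    (hstab : ∀ i j : Fin n, i < j → ∀ m ∈ Submodule.span ℂ B,
      ⁅unitSl i j, m⁆ ∈ Submodule.span ℂ B)
    (x : sl n) {m : M} (hm : m ∈ nMinusClosure n B) : ⁅x, m⁆ ∈ nMinusClosure n B := by
  -- Asking for all `x` at once makes `Q` stable under `n_-`: in `x (y m) = [x, y] m + y (x m)` the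
  -- commutator is again covered.
  let Q : Submodule ℂ M :=
    { carrier := {m | m ∈ nMinusClosure n B ∧ ∀ x : sl n, ⁅x, m⁆ ∈ nMinusClosure n B}
      zero_mem' := ⟨zero_mem _, fun x => by rw [lie_zero]; exact zero_mem _⟩
      add_mem' := fun ha hb => ⟨add_mem ha.1 hb.1, fun x => by
        rw [lie_add]; exact add_mem (ha.2 x) (hb.2 x)⟩
      smul_mem' := fun c a ha => ⟨Submodule.smul_mem _ c ha.1, fun x => by
        rw [lie_smul]; exact Submodule.smul_mem _ c (ha.2 x)⟩ }
  have hQ : nMinusClosure n B ≤ Q := by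
    refine nMinusClosure_le (fun b hb => ?_) fun i j hij m hm => ?_
    · have hb' : b ∈ nMinusClosure n B := span_le_nMinusClosure B (Submodule.subset_span hb)
      refine ⟨hb', fun x => ?_⟩
      rw [lie_eq_sum_unitSl]
      refine sum_mem fun i _ => sum_mem fun j _ => Submodule.smul_mem _ _ ?_
      rcases lt_trichotomy i j with h | h | h
      · exact span_le_nMinusClosure B (hstab i j h b (Submodule.subset_span hb))
      · subst h
        obtain ⟨wt, hwt⟩ := hB b hb
        have e : ⁅unitSl i i, b⁆ = wt (diagSl i) • b := hwt (diagSl i)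
        rw [e]
        exact Submodule.smul_mem _ _ hb'
      · exact nMinusClosure_stable B i j h b hb'
    · refine ⟨nMinusClosure_stable B i j hij m hm.1, fun x => ?_⟩
      rw [leibniz_lie]
      exact add_mem (hm.2 _) (nMinusClosure_stable B i j hij _ (hm.2 x))
  exact (hQ hm).2 x

/-- The generators lie in a finite-dimensional `n_+`-stable space spanned by weight vectors. Its
`n_-`-closure is already `sl_n`-stable, hence everything; this replaces the factorization `U(n_-)
U(h) U(n_+)`. -/
theorem IsInO.isNMinusFG (hM : IsInO n M) : IsNMinusFG n M := by
  classical
  obtain ⟨⟨S, hS⟩, hfin, hw⟩ := hM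
  choose C hC1 hC2 hC3 using exists_finset_of_vector hw.submodule_iSup_eq_top hfin
  have hspan : Submodule.span ℂ (S.biUnion C : Set M) =
      ⨆ s ∈ S, Submodule.span ℂ (C s : Set M) := by
    rw [Finset.coe_biUnion, Submodule.span_iUnion₂]; rfl
  have hB : ∀ b ∈ (S.biUnion C : Set M), ∃ wt : Weight n, b ∈ weightSpace M wt := by
    intro b hb
    obtain ⟨s, -, hs⟩ := Finset.mem_biUnion.1 hb
    exact hC2 s b hs
  have hstab : ∀ i j : Fin n, i < j → ∀ m ∈ Submodule.span ℂ (S.biUnion C : Set M),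
      ⁅unitSl i j, m⁆ ∈ Submodule.span ℂ (S.biUnion C : Set M) := by
    intro i j hij m hm
    have hle : ∀ s ∈ S, Submodule.span ℂ (C s : Set M) ≤
        Submodule.span ℂ (S.biUnion C : Set M) := fun s hs =>
      Submodule.span_mono (Finset.coe_subset.2 (Finset.subset_biUnion_of_mem C hs))
    induction hm using Submodule.span_induction with
    | mem b hb =>
      obtain ⟨s, hs, hb⟩ := Finset.mem_biUnion.1 hb
      exact hle s hs (hC3 s i j hij b (Submodule.subset_span hb))
    | zero => rw [lie_zero]; exact zero_mem _
    | add a b _ _ ha hb => rw [lie_add]; exact add_mem ha hb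
    | smul c a _ ha => rw [lie_smul]; exact Submodule.smul_mem _ _ ha
  refine ⟨S.biUnion C, Finset.finite_toSet _, hB, fun P hBP hP => ?_⟩
  refine top_le_iff.1 (le_trans ?_ (nMinusClosure_le hBP hP))
  rw [← hS, Submodule.span_le]
  rintro _ ⟨a, s, hs, rfl⟩
  refine envAction_mem (fun x m hm => lie_mem_nMinusClosure hB hstab x hm) a ?_
  exact span_le_nMinusClosure _ (Submodule.span_mono
    (Finset.coe_subset.2 (Finset.subset_biUnion_of_mem C hs)) (hC1 s))

end CategoryONMinusFG

/-! ### Tensoring with `V_n^{⊗ l}` -/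

section Tensor

variable {n : ℕ} {M V : Type*} [AddCommGroup M] [Module ℂ M] [LieRingModule (sl n) M]
  [LieModule ℂ (sl n) M] [AddCommGroup V] [Module ℂ V] [LieRingModule (sl n) V]
  [LieModule ℂ (sl n) V]

theorem tmul_mem_weightSpace {wt wt' : Weight n} {m : M} {v : V} (hm : m ∈ weightSpace M wt)
    (hv : v ∈ weightSpace V wt') : m ⊗ₜ[ℂ] v ∈ weightSpace (M ⊗[ℂ] V) (wt + wt') := by
  intro h
  have hm' : ⁅(h : sl n), m⁆ = wt h • m := hm h
  have hv' : ⁅(h : sl n), v⁆ = wt' h • v := hv h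
  change ⁅(h : sl n), m ⊗ₜ[ℂ] v⁆ = _
  rw [TensorProduct.LieModule.lie_tmul_right, hm', hv', LinearMap.add_apply, add_smul,
    TensorProduct.smul_tmul', TensorProduct.tmul_smul]

theorem IsNMinusFG.tensor (hM : IsNMinusFG n M) {C : Set V} (hC : C.Finite)
    (hwt : ∀ v ∈ C, ∃ wt : Weight n, v ∈ weightSpace V wt) (hspan : Submodule.span ℂ C = ⊤) :
    IsNMinusFG n (M ⊗[ℂ] V) := by
  obtain ⟨B, hB, hBwt, hmin⟩ := hM
  refine ⟨Set.image2 (fun m v => m ⊗ₜ[ℂ] v) B C, hB.image2 _ hC, ?_, fun P hBP hP => ?_⟩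
  · rintro _ ⟨m, hm, v, hv, rfl⟩
    obtain ⟨wt, h⟩ := hBwt m hm
    obtain ⟨wt', h'⟩ := hwt v hv
    exact ⟨_, tmul_mem_weightSpace h h'⟩
  · let Q : Submodule ℂ M :=
      { carrier := {m | ∀ v : V, m ⊗ₜ[ℂ] v ∈ P}
        zero_mem' := fun v => by rw [TensorProduct.zero_tmul]; exact zero_mem _
        add_mem' := fun ha hb v => by rw [TensorProduct.add_tmul]; exact add_mem (ha v) (hb v)
        smul_mem' := fun c a ha v => by
          rw [← TensorProduct.smul_tmul']; exact P.smul_mem c (ha v) }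
    have hQ : Q = ⊤ := by
      refine hmin Q (fun b hb v => ?_) fun i j hij m hm v => ?_
      · have hv : v ∈ Submodule.span ℂ C := hspan ▸ Submodule.mem_top
        induction hv using Submodule.span_induction with
        | mem v hv => exact hBP ⟨b, hb, v, hv, rfl⟩
        | zero => rw [TensorProduct.tmul_zero]; exact zero_mem _
        | add x y _ _ hx hy => rw [TensorProduct.tmul_add]; exact add_mem hx hy
        | smul c x _ hx => rw [TensorProduct.tmul_smul]; exact P.smul_mem c hx
      -- The identity `y m ⊗ v = y (m ⊗ v) - m ⊗ y v` makes `Q` stable under `n_-`.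
      · have e := TensorProduct.LieModule.lie_tmul_right (R := ℂ) (unitSl i j) m v
        rw [eq_sub_of_add_eq e.symm]
        exact P.sub_mem (hP i j hij _ (hm v)) (hm _)
    refine top_le_iff.1 fun t _ => ?_
    induction t using TensorProduct.induction_on with
    | zero => exact zero_mem _
    | tmul m v => exact (show m ∈ Q from hQ ▸ Submodule.mem_top) v
    | add x y hx hy => exact add_mem (hx trivial) (hy trivial)

/-- The weight `ε_i`. -/
def epsilon (i : Fin n) : Weight n where
  toFun h := (h : sl n).val i i
  map_add' _ _ := rfl
  map_smul' _ _ := rfl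

theorem single_mem_weightSpace (i : Fin n) :
    (Pi.single i 1 : Fin n → ℂ) ∈ weightSpace (Fin n → ℂ) (epsilon i) := by
  intro h
  change (h : sl n).val.mulVec (Pi.single i 1) = (h : sl n).val i i • Pi.single i 1
  rw [Matrix.mulVec_single_one]
  ext j
  by_cases e : j = i
  · subst e; simp
  · simp [h.2 j i e, e]

theorem tprod_mem_weightSpace {l : ℕ} (v : Fin l → V) (wt : Fin l → Weight n)
    (hv : ∀ k, v k ∈ weightSpace V (wt k)) :
    PiTensorProduct.tprod ℂ v ∈ weightSpace (⨂[ℂ]^l V) (∑ k, wt k) := by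
  intro h
  change tensorPowerAction (h : sl n) (PiTensorProduct.tprod ℂ v) = _
  rw [tensorPowerAction, LinearMap.sum_apply, LinearMap.sum_apply, Finset.sum_smul]
  refine Finset.sum_congr rfl fun k _ => ?_
  have hk : ⁅(h : sl n), v k⁆ = wt k h • v k := hv k h
  rw [atPlace]
  refine (PiTensorProduct.map_tprod _ _).trans ?_
  have e : (fun i => (Function.update (fun _ : Fin l => (LinearMap.id : V →ₗ[ℂ] V)) k
      (LieModule.toEnd ℂ (sl n) V h)) i (v i)) = Function.update v k (wt k h • v k) := by
    funext i
    by_cases hi : i = k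
    · subst hi; simp [hk]
    · simp [hi]
  rw [e, MultilinearMap.map_update_smul, Function.update_eq_self]

theorem IsNMinusFG.tensorPower (hM : IsNMinusFG n M) (l : ℕ) :
    IsNMinusFG n (M ⊗[ℂ] (⨂[ℂ]^l (Fin n → ℂ))) := by
  let b := Basis.piTensorProduct fun _ : Fin l => Pi.basisFun ℂ (Fin n)
  refine hM.tensor (C := Set.range b) (Set.finite_range b) ?_ b.span_eq
  rintro _ ⟨p, rfl⟩
  refine ⟨∑ k, epsilon (p k), ?_⟩
  have e : b p = PiTensorProduct.tprod ℂ fun k => (Pi.single (p k) 1 : Fin n → ℂ) := by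
    refine (Basis.piTensorProduct_apply _ p).trans ?_
    simp
  rw [e]
  exact tprod_mem_weightSpace _ _ fun k => single_mem_weightSpace (p k)

end Tensor

/-! ### The Casimir operator -/

theorem commute_sum_mul_of_matrixUnit_relations {R : Type*} [Ring R] {n : ℕ}
    (e : Fin n → Fin n → R)
    (he : ∀ a b c d, e a b * e c d =
      e c d * e a b + (if b = c then e a d else 0) - (if d = a then e c b else 0))
    (a b : Fin n) : e a b * (∑ i, ∑ j, e i j * e j i) = (∑ i, ∑ j, e i j * e j i) * e a b := by
  have h : ∀ i j, e a b * (e i j * e j i) = e i j * e j i * e a b +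
      ((if b = j then e i j * e a i else 0) - (if i = a then e i j * e j b else 0) +
      ((if b = i then e a j * e j i else 0) - (if j = a then e i b * e j i else 0))) := by
    intro i j
    rw [← mul_assoc, he a b i j, sub_mul, add_mul, mul_assoc (e i j), he a b j i, mul_sub, mul_add]
    simp only [mul_ite, ite_mul, zero_mul, mul_zero, mul_assoc]
    abel
  simp only [Finset.mul_sum, Finset.sum_mul, h, Finset.sum_add_distrib, Finset.sum_sub_distrib]
  rw [add_eq_left]
  -- The four families of correction terms cancel in pairs, the first with the fourth and the second
  -- with the third.
  have h1 : ∑ i, ∑ j, (if b = j then e i j * e a i else 0) = ∑ i, e i b * e a i := by simp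
  have h2 : ∑ i, ∑ j, (if i = a then e i j * e j b else 0) = ∑ j, e a j * e j b := by
    rw [Finset.sum_comm]; simp
  have h3 : ∑ i, ∑ j, (if b = i then e a j * e j i else 0) = ∑ j, e a j * e j b := by
    rw [Finset.sum_comm]; simp
  have h4 : ∑ i, ∑ j, (if j = a then e i b * e j i else 0) = ∑ i, e i b * e a i := by simp
  rw [h1, h2, h3, h4]
  abel

theorem sum_sum_eq_diag_add_sum_lt {A : Type*} [AddCommGroup A] {n : ℕ}
    (g : Fin n → Fin n → A) : ∑ i, ∑ j, g i j =
      ∑ i, g i i + ∑ p : Fin n × Fin n with p.1 < p.2, (g p.1 p.2 + g p.2 p.1) := by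
  have h : ∀ i j, g i j = (if i = j then g i j else 0) +
      ((if i < j then g i j else 0) + (if j < i then g i j else 0)) := by
    intro i j
    rcases lt_trichotomy i j with h | h | h
    · simp [h, h.ne, h.not_gt]
    · simp [h]
    · simp [h, h.ne', h.not_gt]
  rw [Finset.sum_congr rfl fun i _ => Finset.sum_congr rfl fun j _ => h i j]
  simp only [Finset.sum_add_distrib, Finset.sum_ite_eq, Finset.mem_univ, if_true,
    Finset.sum_filter]
  congr 2
  · rw [← Finset.univ_product_univ, Finset.sum_product]
  · rw [Finset.sum_comm, ← Finset.univ_product_univ, Finset.sum_product]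

section Casimir

variable {n : ℕ} {M N : Type*} [AddCommGroup M] [Module ℂ M] [LieRingModule (sl n) M]
  [LieModule ℂ (sl n) M] [AddCommGroup N] [Module ℂ N] [LieRingModule (sl n) N]
  [LieModule ℂ (sl n) N]

/-- The action of the Casimir element on an `sl_n`-module. -/
def casimir (n : ℕ) (M : Type*) [AddCommGroup M] [Module ℂ M] [LieRingModule (sl n) M]
    [LieModule ℂ (sl n) M] : Module.End ℂ M :=
  ∑ i, ∑ j, LieModule.toEnd ℂ (sl n) M (unitSl i j) * LieModule.toEnd ℂ (sl n) M (unitSl j i)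

theorem casimir_apply (m : M) :
    casimir n M m = ∑ i : Fin n, ∑ j : Fin n, ⁅unitSl i j, ⁅unitSl j i, m⁆⁆ := by
  simp [casimir, LinearMap.sum_apply]

theorem map_casimir (f : M →ₗ⁅ℂ, sl n⁆ N) (m : M) : f (casimir n M m) = casimir n N (f m) := by
  simp [casimir_apply, map_sum, LieModuleHom.map_lie]

theorem unitSl_lie_lie (a b c d : Fin n) (m : M) : ⁅unitSl a b, ⁅unitSl c d, m⁆⁆ =
    ⁅unitSl c d, ⁅unitSl a b, m⁆⁆ + (if b = c then ⁅unitSl a d, m⁆ else 0) -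
      (if d = a then ⁅unitSl c b, m⁆ else 0) := by
  rw [leibniz_lie, unitSl_lie, sub_lie, smul_lie, smul_lie, ite_smul, ite_smul]
  simp only [one_smul, zero_smul]
  abel

theorem casimir_unitSl_lie (a b : Fin n) (m : M) :
    casimir n M ⁅unitSl a b, m⁆ = ⁅unitSl a b, casimir n M m⁆ := by
  have h := commute_sum_mul_of_matrixUnit_relations
    (fun i j => LieModule.toEnd ℂ (sl n) M (unitSl i j)) (fun a b c d => by
      ext m
      have := unitSl_lie_lie a b c d m
      split_ifs at this ⊢ <;> simpa using this) a b
  exact (LinearMap.congr_fun h m).symm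

theorem casimir_lie (x : sl n) (m : M) : casimir n M ⁅x, m⁆ = ⁅x, casimir n M m⁆ := by
  rw [lie_eq_sum_unitSl, lie_eq_sum_unitSl x (casimir n M m)]
  simp only [map_sum, map_smul, casimir_unitSl_lie]

/-- The scalar by which the Casimir element acts on a highest weight vector of weight `wt`. -/
def casimirScalar (wt : Weight n) : ℂ :=
  ∑ i, wt (diagSl i) ^ 2 +
    ∑ p : Fin n × Fin n with p.1 < p.2, (wt (diagSl p.1) - wt (diagSl p.2))

/-- For `i < j`, rewriting `e_ij e_ji` as `e_ji e_ij + e_ii - e_jj` produces the linear part of the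
scalar and doubles the remaining term. -/
theorem casimir_of_mem_weightSpace {wt : Weight n} {v : M} (hv : v ∈ weightSpace M wt) :
    casimir n M v = casimirScalar wt • v + (2 : ℂ) •
      ∑ p : Fin n × Fin n with p.1 < p.2, ⁅unitSl p.2 p.1, ⁅unitSl p.1 p.2, v⁆⁆ := by
  have hd : ∀ i, ⁅unitSl i i, v⁆ = wt (diagSl i) • v := fun i => hv (diagSl i)
  rw [casimir_apply, sum_sum_eq_diag_add_sum_lt, casimirScalar, add_smul, Finset.sum_smul,
    Finset.sum_smul, add_assoc, Finset.smul_sum, ← Finset.sum_add_distrib]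
  congr 1
  · refine Finset.sum_congr rfl fun i _ => ?_
    rw [hd, lie_smul, hd, smul_smul, sq]
  · refine Finset.sum_congr rfl fun p _ => ?_
    rw [unitSl_lie_lie p.1 p.2 p.2 p.1 v, if_pos rfl, if_pos rfl, hd, hd, sub_smul, two_smul]
    abel

/-- The Casimir element minus its value on highest weight vectors of weight `wt`. -/
def shiftedCasimir (M : Type*) [AddCommGroup M] [Module ℂ M] [LieRingModule (sl n) M]
    [LieModule ℂ (sl n) M] (wt : Weight n) : Module.End ℂ M :=
  casimir n M - casimirScalar wt • LinearMap.id

theorem shiftedCasimir_apply (wt : Weight n) (m : M) :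
    shiftedCasimir M wt m = casimir n M m - casimirScalar wt • m := rfl

theorem shiftedCasimir_lie (wt : Weight n) (x : sl n) (m : M) :
    shiftedCasimir M wt ⁅x, m⁆ = ⁅x, shiftedCasimir M wt m⁆ := by
  rw [shiftedCasimir_apply, shiftedCasimir_apply, casimir_lie, lie_sub, lie_smul]

theorem map_shiftedCasimir (f : M →ₗ⁅ℂ, sl n⁆ N) (wt : Weight n) (m : M) :
    f (shiftedCasimir M wt m) = shiftedCasimir N wt (f m) := by
  rw [shiftedCasimir_apply, shiftedCasimir_apply, map_sub, map_smul, map_casimir]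

theorem shiftedCasimir_mem_weightSpace (wt : Weight n) {wt' : Weight n} {v : M}
    (hv : v ∈ weightSpace M wt') : shiftedCasimir M wt v ∈ weightSpace M wt' := by
  intro h
  have hv' : ⁅(h : sl n), v⁆ = wt' h • v := hv h
  change ⁅(h : sl n), _⁆ = _
  rw [← shiftedCasimir_lie, hv', map_smul]

end Casimir

/-! ### Separation of Casimir scalars by dominance -/

section Dominance

variable {n : ℕ}

/-- `wt'` exceeds `wt` by a real combination of roots that pairs nonnegatively with the real part
of `wt + ρ`. -/
def IsAbove (wt wt' : Weight n) : Prop :=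
  ∃ β : Fin n → ℝ, (∀ i, wt' (diagSl i) = wt (diagSl i) + β i) ∧
    0 ≤ ∑ i, β i * ((wt + rho n) (diagSl i)).re

theorem isAbove_self (wt : Weight n) : IsAbove wt wt := ⟨0, by simp, by simp⟩

/-- Consecutive coordinates differ by the value on a simple coroot, and the inequalities telescope.
-/
theorem IsDominantIntegral.re_le {wt : Weight n} (h : IsDominantIntegral wt) {i j : Fin n}
    (hij : i ≤ j) : (wt (diagSl j)).re ≤ (wt (diagSl i)).re := by
  obtain ⟨d, hd⟩ := Nat.exists_eq_add_of_le (Fin.le_def.1 hij)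
  induction d generalizing j with
  | zero => rw [Fin.ext hd]
  | succ d ih =>
    have hk : (i : ℕ) + d < n := by omega
    have h1 := ih (j := ⟨i + d, hk⟩) (Fin.le_def.2 (by simp)) rfl
    obtain ⟨m, hm⟩ := h ⟨i + d, hk⟩ j (by simp; omega)
    rw [coroot_eq, map_sub] at hm
    have := congrArg Complex.re hm
    rw [Complex.sub_re, Complex.natCast_re] at this
    have hm0 : (0 : ℝ) ≤ m := Nat.cast_nonneg m
    linarith

theorem IsAbove.add_root {wt wt' : Weight n} (hwt : IsDominantIntegral (wt + rho n))
    (h : IsAbove wt wt') {i j : Fin n} (hij : i < j) : IsAbove wt (wt' + root i j) := by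
  obtain ⟨β, h1, h2⟩ := h
  refine ⟨fun k => β k + ((if k = i then 1 else 0) - (if k = j then 1 else 0)), fun k => ?_, ?_⟩
  · rw [LinearMap.add_apply, h1, root_diagSl]
    simp only [Complex.ofReal_add, Complex.ofReal_sub, apply_ite Complex.ofReal,
      Complex.ofReal_one, Complex.ofReal_zero]
    ring
  · have := hwt.re_le hij.le
    simp only [add_mul, sub_mul, Finset.sum_add_distrib, Finset.sum_sub_distrib, ite_mul, one_mul,
      zero_mul, Finset.sum_ite_eq', Finset.mem_univ, if_true]
    linarith

/-- Identifies the linear term of `casimirScalar` with twice the pairing with `ρ`, so that the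
square can be completed. -/
theorem sum_mul_rho (β : Fin n → ℂ) : 2 * ∑ k, β k * rho n (diagSl k) =
    ∑ p : Fin n × Fin n with p.1 < p.2, (β p.1 - β p.2) := by
  have h : ∀ k, rho n (diagSl k) = (1 / 2 : ℂ) * ∑ p : Fin n × Fin n with p.1 < p.2,
      ((if k = p.1 then (1 : ℂ) else 0) - (if k = p.2 then 1 else 0)) := by
    intro k
    rw [rho, LinearMap.smul_apply, LinearMap.sum_apply, smul_eq_mul]
    simp only [root_diagSl]
  simp only [h, Finset.mul_sum]
  rw [Finset.sum_comm]
  refine Finset.sum_congr rfl fun p _ => ?_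
  have e : ∀ k, 2 * (β k * (1 / 2 * ((if k = p.1 then (1 : ℂ) else 0) -
      (if k = p.2 then 1 else 0)))) =
      (if k = p.1 then β k else 0) - (if k = p.2 then β k else 0) := by
    intro k
    split_ifs <;> ring
  simp only [e, Finset.sum_sub_distrib, Finset.sum_ite_eq', Finset.mem_univ, if_true]

theorem casimirScalar_eq (wt : Weight n) :
    casimirScalar wt = ∑ i, (wt (diagSl i) ^ 2 + 2 * (wt (diagSl i) * rho n (diagSl i))) := by
  rw [casimirScalar, ← sum_mul_rho (fun i => wt (diagSl i)), Finset.sum_add_distrib,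
    Finset.mul_sum]

/-- The real part of the difference is `∑ β_i²` plus a nonnegative pairing. If it vanished, `β`
would be zero and the two heights would agree. -/
theorem IsAbove.casimirScalar_ne {wt wt' : Weight n} (h : IsAbove wt wt')
    (hlt : height wt < height wt') : casimirScalar wt' ≠ casimirScalar wt := by
  obtain ⟨β, h1, h2⟩ := h
  intro heq
  have e : casimirScalar wt' - casimirScalar wt =
      ∑ i, ((β i : ℂ) ^ 2 + 2 * (β i * (wt + rho n) (diagSl i))) := by
    rw [casimirScalar_eq, casimirScalar_eq, ← Finset.sum_sub_distrib]
    refine Finset.sum_congr rfl fun i _ => ?_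
    rw [h1, LinearMap.add_apply]
    ring
  rw [heq, sub_self] at e
  have e' : (0 : ℝ) = ∑ i, (β i ^ 2) + 2 * ∑ i, β i * ((wt + rho n) (diagSl i)).re := by
    have := congrArg Complex.re e
    rw [Complex.re_sum] at this
    rw [Finset.mul_sum, ← Finset.sum_add_distrib]
    refine this.trans (Finset.sum_congr rfl fun i _ => ?_)
    simp [← Complex.ofReal_pow]
  have hsq : ∑ i, β i ^ 2 = 0 :=
    le_antisymm (by linarith) (Finset.sum_nonneg fun i _ => sq_nonneg _)
  have hβ : ∀ i, β i = 0 := fun i => by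
    have := (Finset.sum_eq_zero_iff_of_nonneg fun i _ => sq_nonneg (β i)).1 hsq i
      (Finset.mem_univ i)
    simpa using this
  refine hlt.ne ?_
  change -∑ k : Fin n, (k : ℝ) * (wt (diagSl k)).re = -∑ k : Fin n, (k : ℝ) * (wt' (diagSl k)).re
  simp [h1, hβ]

end Dominance

/-! ### Bijectivity of the shifted Casimir operator -/

section Bijectivity

variable {n : ℕ} {M : Type*} [AddCommGroup M] [Module ℂ M] [LieRingModule (sl n) M]
  [LieModule ℂ (sl n) M]

theorem IsNMinusFG.eq_zero_of_shiftedCasimir_eq_zero (hM : IsNMinusFG n M) {wt wt' : Weight n}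
    (hwt : IsDominantIntegral (wt + rho n)) (hab : IsAbove wt wt')
    (hlt : height wt < height wt') {v : M} (hv : v ∈ weightSpace M wt')
    (h0 : shiftedCasimir M wt v = 0) : v = 0 := by
  obtain ⟨R, hR⟩ := hM.exists_height_bound
  -- `k` bounds the number of raisings left before the weight spaces vanish, as each one adds at
  -- least one to the height.
  obtain ⟨k, hk⟩ := exists_nat_gt (R - height wt')
  induction k generalizing wt' v with
  | zero =>
    have := hR wt' (by simpa using hk)
    rw [this] at hv
    exact hv
  | succ k ih =>
    have hz : ∀ p : Fin n × Fin n, p.1 < p.2 → ⁅unitSl p.1 p.2, v⁆ = 0 := by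
      intro p hp
      have := one_le_height_root hp
      refine ih (hab.add_root hwt hp) ?_ (unitSl_lie_mem_weightSpace hv p.1 p.2) ?_ ?_
      · rw [map_add]; linarith
      · rw [shiftedCasimir_lie, h0, lie_zero]
      · push_cast at hk; rw [map_add]; linarith
    -- All raising operators kill `v`, so the Casimir element acts on it by `casimirScalar wt'`.
    have hc := casimir_of_mem_weightSpace hv
    rw [Finset.sum_eq_zero fun p hp => by rw [hz p (Finset.mem_filter.1 hp).2, lie_zero],
      smul_zero, add_zero] at hc
    rw [shiftedCasimir_apply, hc, ← sub_smul] at h0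
    exact (smul_eq_zero.1 h0).resolve_left (sub_ne_zero.2 (hab.casimirScalar_ne hlt))

theorem IsNMinusFG.exists_shiftedCasimir_eq (hM : IsNMinusFG n M) {wt wt' : Weight n}
    (hwt : IsDominantIntegral (wt + rho n)) (hab : IsAbove wt wt')
    (hlt : height wt < height wt') {v : M} (hv : v ∈ weightSpace M wt') :
    ∃ w ∈ weightSpace M wt', shiftedCasimir M wt w = v := by
  have := hM.finiteDimensional_weightSpace wt'
  let T := (shiftedCasimir M wt).restrict
    (p := weightSpace M wt') fun v hv => shiftedCasimir_mem_weightSpace wt hv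
  have hinj : Function.Injective T := by
    rw [← LinearMap.ker_eq_bot, LinearMap.ker_eq_bot']
    rintro ⟨w, hw⟩ h
    exact Subtype.ext (hM.eq_zero_of_shiftedCasimir_eq_zero hwt hab hlt hw
      (congrArg Subtype.val h))
  obtain ⟨w, hw⟩ := LinearMap.injective_iff_surjective.1 hinj ⟨v, hv⟩
  exact ⟨w, w.2, congrArg Subtype.val hw⟩

/-- The span of the images in weight `wt` of the weight vectors under negative root vectors. -/
def nMinusMulWeight (M : Type*) [AddCommGroup M] [Module ℂ M] [LieRingModule (sl n) M]
    [LieModule ℂ (sl n) M] (wt : Weight n) : Submodule ℂ M :=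
  Submodule.span ℂ {m | ∃ i j : Fin n, j < i ∧ ∃ v ∈ weightSpace M (wt + root j i),
    ⁅unitSl i j, v⁆ = m}

theorem root_add_root_swap (i j : Fin n) : root j i + root i j = 0 := by
  ext h
  change ((h : sl n).val j j - (h : sl n).val i i) + ((h : sl n).val i i - (h : sl n).val j j) = 0
  ring

theorem nMinusMulWeight_le_weightSpace (wt : Weight n) :
    nMinusMulWeight M wt ≤ weightSpace M wt := by
  refine Submodule.span_le.2 ?_
  rintro _ ⟨i, j, -, v, hv, rfl⟩
  exact unitSl_lie_mem_weightSpace' hv i j (by rw [add_assoc, root_add_root_swap, add_zero])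

theorem nMinusMulWeight_le_nMinusMul (wt : Weight n) :
    nMinusMulWeight M wt ≤ (nMinusMul n M).toSubmodule := by
  refine Submodule.span_le.2 ?_
  rintro _ ⟨i, j, hij, v, -, rfl⟩
  exact Submodule.subset_span ⟨⟨unitSl i j, unitSl_mem_nMinus hij⟩, v, rfl⟩

theorem IsNMinusFG.nMinusMul_le_iSup (hM : IsNMinusFG n M) :
    (nMinusMul n M).toSubmodule ≤ ⨆ wt : Weight n, nMinusMulWeight M wt := by
  refine Submodule.span_le.2 ?_
  rintro _ ⟨y, v, rfl⟩
  change ⁅(y : sl n), v⁆ ∈ _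
  rw [SetLike.mem_coe, lie_eq_sum_unitSl]
  refine sum_mem fun i _ => sum_mem fun j _ => ?_
  rcases lt_or_ge j i with hij | hij
  · refine Submodule.smul_mem _ _ ?_
    have hv : v ∈ ⨆ wt : Weight n, weightSpace M wt := hM.iSup_weightSpace ▸ Submodule.mem_top
    induction hv using Submodule.iSup_induction' with
    | mem wt x hx =>
      refine Submodule.mem_iSup_of_mem (wt + root i j)
        (Submodule.subset_span ⟨i, j, hij, x, ?_, rfl⟩)
      rwa [add_assoc, root_add_root_swap, add_zero]
    | zero => rw [lie_zero]; exact zero_mem _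
    | add a b _ _ ha hb => rw [lie_add]; exact add_mem ha hb
  · rw [y.2 i j hij, zero_smul]; exact zero_mem _

theorem IsNMinusFG.mem_nMinusMulWeight (hM : IsNMinusFG n M) {wt : Weight n} {m : M}
    (hm : m ∈ weightSpace M wt) (h : m ∈ nMinusMul n M) : m ∈ nMinusMulWeight M wt :=
  mem_of_mem_iSup_of_iSupIndep (iSupIndep_weightSpace M) nMinusMulWeight_le_weightSpace
    (hM.nMinusMul_le_iSup h) hm

theorem shiftedCasimir_mem_nMinusMulWeight {wt : Weight n} {v : M}
    (hv : v ∈ weightSpace M wt) : shiftedCasimir M wt v ∈ nMinusMulWeight M wt := by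
  rw [shiftedCasimir_apply, casimir_of_mem_weightSpace hv, add_sub_cancel_left]
  refine Submodule.smul_mem _ _ (sum_mem fun p hp => ?_)
  exact Submodule.subset_span ⟨p.2, p.1, (Finset.mem_filter.1 hp).2, _,
    unitSl_lie_mem_weightSpace hv p.1 p.2, rfl⟩

/-- On a generator `y v`, with `v` in a higher weight space, write `v = T w`; then `y v = T (y w)`
because `T` commutes with `y`. -/
theorem IsNMinusFG.shiftedCasimir_surjOn (hM : IsNMinusFG n M) {wt : Weight n}
    (hwt : IsDominantIntegral (wt + rho n)) {a : M} (ha : a ∈ nMinusMulWeight M wt) :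
    ∃ b ∈ nMinusMulWeight M wt, shiftedCasimir M wt b = a := by
  change a ∈ Submodule.span ℂ _ at ha
  induction ha using Submodule.span_induction with
  | mem a ha =>
    obtain ⟨i, j, hij, v, hv, rfl⟩ := ha
    have := one_le_height_root hij
    obtain ⟨w, hw, rfl⟩ := hM.exists_shiftedCasimir_eq hwt
      ((isAbove_self wt).add_root hwt hij) (by rw [map_add]; linarith) hv
    exact ⟨⁅unitSl i j, w⁆, Submodule.subset_span ⟨i, j, hij, w, hw, rfl⟩,
      shiftedCasimir_lie _ _ _⟩
  | zero => exact ⟨0, zero_mem _, map_zero _⟩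
  | add x y _ _ hx hy =>
    obtain ⟨a, ha, rfl⟩ := hx
    obtain ⟨b, hb, rfl⟩ := hy
    exact ⟨a + b, add_mem ha hb, map_add _ _ _⟩
  | smul c x _ hx =>
    obtain ⟨a, ha, rfl⟩ := hx
    exact ⟨c • a, Submodule.smul_mem _ c ha, map_smul _ _ _⟩

theorem IsNMinusFG.eq_zero_of_mem_nMinusMulWeight (hM : IsNMinusFG n M) {wt : Weight n}
    (hwt : IsDominantIntegral (wt + rho n)) {a : M} (ha : a ∈ nMinusMulWeight M wt)
    (h0 : shiftedCasimir M wt a = 0) : a = 0 := by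
  have := hM.finiteDimensional_weightSpace wt
  have : FiniteDimensional ℂ (nMinusMulWeight M wt) :=
    Submodule.finiteDimensional_of_le (nMinusMulWeight_le_weightSpace wt)
  let T := (shiftedCasimir M wt).restrict (p := nMinusMulWeight M wt) fun v hv =>
    shiftedCasimir_mem_nMinusMulWeight (nMinusMulWeight_le_weightSpace wt hv)
  have hsurj : Function.Surjective T := by
    rintro ⟨a, ha⟩
    obtain ⟨b, hb, h⟩ := hM.shiftedCasimir_surjOn hwt ha
    exact ⟨⟨b, hb⟩, Subtype.ext h⟩
  have hinj := LinearMap.injective_iff_surjective.2 hsurj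
  have : (⟨a, ha⟩ : nMinusMulWeight M wt) = 0 := hinj ((Subtype.ext h0).trans (map_zero T).symm)
  exact congrArg Subtype.val this

end Bijectivity

/-! ### Exactness on weight spaces of `H_0` -/

section Exactness

variable {n : ℕ} {M N P : Type*} [AddCommGroup M] [Module ℂ M] [LieRingModule (sl n) M]
  [LieModule ℂ (sl n) M] [AddCommGroup N] [Module ℂ N] [LieRingModule (sl n) N]
  [LieModule ℂ (sl n) N] [AddCommGroup P] [Module ℂ P] [LieRingModule (sl n) P]
  [LieModule ℂ (sl n) P]

theorem mk_mem_weightSpace {wt : Weight n} {m : M} (hm : m ∈ weightSpace M wt) :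
    (LieSubmodule.Quotient.mk m : H0 n M) ∈ weightSpace (H0 n M) wt := by
  intro h
  change LieSubmodule.Quotient.mk (N := nMinusMul n M) ⁅h, m⁆ = _
  rw [hm h]
  rfl

theorem map_mem_weightSpace (f : M →ₗ⁅ℂ, sl n⁆ N) {wt : Weight n} {m : M}
    (hm : m ∈ weightSpace M wt) : f m ∈ weightSpace N wt := by
  intro h
  have hm' : ⁅(h : sl n), m⁆ = wt h • m := hm h
  change ⁅(h : sl n), f m⁆ = _
  rw [← LieModuleHom.map_lie, hm', map_smul]

/-- The image of `f` is the sum of the images of the weight spaces, so its part of weight `wt`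
already comes from weight `wt`. -/
theorem exists_weightVector_of_map_mem {K : Type*} [AddCommGroup K] [Module ℂ K]
    [LieRingModule (cartan n) K] [LieModule ℂ (cartan n) K]
    (hM : ⨆ wt : Weight n, weightSpace M wt = ⊤) (f : M →ₗ[ℂ] K)
    (hf : ∀ wt : Weight n, ∀ m ∈ weightSpace M wt, f m ∈ weightSpace K wt) {wt : Weight n} {m : M}
    (h : f m ∈ weightSpace K wt) : ∃ m' ∈ weightSpace M wt, f m' = f m := by
  have h1 : f m ∈ ⨆ wt : Weight n, (weightSpace M wt).map f := by
    rw [← Submodule.map_iSup, hM]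
    exact ⟨m, trivial, rfl⟩
  exact mem_of_mem_iSup_of_iSupIndep (iSupIndep_weightSpace K)
    (fun wt => Submodule.map_le_iff_le_comap.2 fun m hm => hf wt m hm) h1 h

theorem IsNMinusFG.exists_mk_eq (hM : IsNMinusFG n M) {wt : Weight n} {v : H0 n M}
    (hv : v ∈ weightSpace (H0 n M) wt) :
    ∃ m ∈ weightSpace M wt, LieSubmodule.Quotient.mk m = v := by
  obtain ⟨m, rfl⟩ := LieSubmodule.Quotient.surjective_mk' _ v
  exact exists_weightVector_of_map_mem (K := H0 n M) hM.iSup_weightSpace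
    ((nMinusMul n M).toSubmodule.mkQ) (fun wt m hm => mk_mem_weightSpace hm) hv

theorem IsNMinusFG.finite_weightSpace_H0 (hM : IsNMinusFG n M) (wt : Weight n) :
    Module.Finite ℂ (weightSpace (H0 n M) wt) := by
  have := hM.finiteDimensional_weightSpace wt
  refine Module.Finite.of_surjective (((nMinusMul n M).toSubmodule.mkQ).restrict
    (p := weightSpace M wt) (q := weightSpace (H0 n M) wt) fun m hm => mk_mem_weightSpace hm) ?_
  rintro ⟨v, hv⟩
  obtain ⟨m, hm, h⟩ := hM.exists_mk_eq hv
  exact ⟨⟨m, hm⟩, Subtype.ext h⟩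

/-- For `wt + ρ` dominant integral, `(n_- M)_wt` is the intersection of `M_wt` with `n_- N` for
every submodule `M` of `N`. -/
theorem mem_nMinusMul_of_map_mem (hM : IsNMinusFG n M) (hN : IsNMinusFG n N) {wt : Weight n}
    (hwt : IsDominantIntegral (wt + rho n)) (f : M →ₗ⁅ℂ, sl n⁆ N) (hf : Function.Injective f)
    {m : M} (hm : m ∈ weightSpace M wt) (h : f m ∈ nMinusMul n N) : m ∈ nMinusMul n M := by
  -- Here `T m` lies in `(n_- M)_wt`, on which `T` is onto; `m - a` is thus killed by `T`.
  obtain ⟨a, ha, hTa⟩ := hM.shiftedCasimir_surjOn hwt (shiftedCasimir_mem_nMinusMulWeight hm)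
  have haM := nMinusMulWeight_le_nMinusMul wt ha
  have h1 : f (m - a) ∈ nMinusMulWeight N wt := by
    refine hN.mem_nMinusMulWeight (map_mem_weightSpace f
      (sub_mem hm (nMinusMulWeight_le_weightSpace wt ha))) ?_
    have h2 : f a ∈ nMinusMul n N :=
      (Submodule.Quotient.mk_eq_zero _).1 (by
        have := congrArg (H0map f) ((Submodule.Quotient.mk_eq_zero _).2 haM)
        rw [map_zero] at this
        exact this)
    rw [map_sub]
    exact sub_mem h h2
  have h3 : f (m - a) = 0 := hN.eq_zero_of_mem_nMinusMulWeight hwt h1 (by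
    rw [← map_shiftedCasimir, map_sub, hTa, sub_self, map_zero])
  have h4 : m - a = 0 := hf (h3.trans (map_zero f).symm)
  rw [sub_eq_zero.1 h4]
  exact haM

theorem H0weightMap_injective (hM : IsNMinusFG n M) (hN : IsNMinusFG n N) {wt : Weight n}
    (hwt : IsDominantIntegral (wt + rho n)) (f : M →ₗ⁅ℂ, sl n⁆ N) (hf : Function.Injective f) :
    Function.Injective (H0weightMap wt f) := by
  rw [← LinearMap.ker_eq_bot, LinearMap.ker_eq_bot']
  rintro ⟨v, hv⟩ h
  obtain ⟨m, hm, rfl⟩ := hM.exists_mk_eq hv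
  have h' : (LieSubmodule.Quotient.mk (f m) : H0 n N) = 0 := congrArg Subtype.val h
  exact Subtype.ext ((Submodule.Quotient.mk_eq_zero _).2 (mem_nMinusMul_of_map_mem hM hN hwt f hf hm
    ((Submodule.Quotient.mk_eq_zero _).1 h')))

theorem H0weightMap_surjective (hM : IsNMinusFG n M) (hN : IsNMinusFG n N) (wt : Weight n)
    (g : M →ₗ⁅ℂ, sl n⁆ N) (hg : Function.Surjective g) :
    Function.Surjective (H0weightMap wt g) := by
  rintro ⟨v, hv⟩
  obtain ⟨y, hy, rfl⟩ := hN.exists_mk_eq hv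
  obtain ⟨x, rfl⟩ := hg y
  obtain ⟨x', hx', h⟩ := exists_weightVector_of_map_mem hM.iSup_weightSpace (g : M →ₗ[ℂ] N)
    (fun wt m hm => map_mem_weightSpace g hm) hy
  refine ⟨⟨LieSubmodule.Quotient.mk x', mk_mem_weightSpace hx'⟩, Subtype.ext ?_⟩
  exact congrArg (LieSubmodule.Quotient.mk (N := nMinusMul n N)) h

theorem exists_mem_nMinusMul_map_eq (g : M →ₗ⁅ℂ, sl n⁆ N) (hg : Function.Surjective g) {y : N}
    (hy : y ∈ nMinusMul n N) : ∃ x ∈ nMinusMul n M, g x = y := by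
  change y ∈ Submodule.span ℂ _ at hy
  have h : Submodule.span ℂ {m : N | ∃ y : nMinus n, ∃ v : N, ⁅y, v⁆ = m} ≤
      (nMinusMul n M).toSubmodule.map (g : M →ₗ[ℂ] N) := by
    refine Submodule.span_le.2 ?_
    rintro _ ⟨z, v, rfl⟩
    obtain ⟨x, rfl⟩ := hg v
    exact ⟨⁅(z : sl n), x⁆, Submodule.subset_span ⟨z, x, rfl⟩, LieModuleHom.map_lie g (z : sl n) x⟩
  exact h hy

theorem H0weightMap_exact (hM : IsNMinusFG n M) (hN : IsNMinusFG n N) (wt : Weight n)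
    (f : M →ₗ⁅ℂ, sl n⁆ N) (g : N →ₗ⁅ℂ, sl n⁆ P) (hfg : Function.Exact f g)
    (hg : Function.Surjective g) : Function.Exact (H0weightMap wt f) (H0weightMap wt g) := by
  rintro ⟨v, hv⟩
  constructor
  · intro h
    obtain ⟨y, hy, rfl⟩ := hN.exists_mk_eq hv
    have h' : (LieSubmodule.Quotient.mk (g y) : H0 n P) = 0 := congrArg Subtype.val h
    obtain ⟨y', hy', e⟩ := exists_mem_nMinusMul_map_eq g hg
      ((Submodule.Quotient.mk_eq_zero _).1 h')
    -- Correcting `y` by `y' ∈ n_- N` moves it into the kernel of `g` without changing its class.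
    -- The lift `x` need not be a weight vector and is replaced by one below.
    obtain ⟨x, hx⟩ := (hfg (y - y')).1 (by rw [map_sub, e, sub_self])
    have hxy : H0map f (LieSubmodule.Quotient.mk x) = LieSubmodule.Quotient.mk y := by
      rw [H0map_mk, hx]
      exact (Submodule.Quotient.eq _).2 (by simpa using hy')
    obtain ⟨x', hx', e'⟩ := exists_weightVector_of_map_mem (wt := wt) hM.iSup_weightSpace
      ((H0map f).comp (nMinusMul n M).toSubmodule.mkQ)
      (fun wt m hm => mk_mem_weightSpace (map_mem_weightSpace f hm)) (m := x)
      (by exact hxy ▸ hv)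
    exact ⟨⟨LieSubmodule.Quotient.mk x', mk_mem_weightSpace hx'⟩, Subtype.ext (e'.trans hxy)⟩
  · rintro ⟨⟨w, hw⟩, h⟩
    rw [← h]
    obtain ⟨x, hx, rfl⟩ := hM.exists_mk_eq hw
    apply Subtype.ext
    change (LieSubmodule.Quotient.mk (g (f x)) : H0 n P) = 0
    rw [hfg.apply_apply_eq_zero]
    rfl

end Exactness

/-! ### The functor on `O` -/

section Functor

variable {n : ℕ}

theorem CategoryO.isNMinusFG_tensorModule (l : ℕ) (X : CategoryO.{u} n) :
    IsNMinusFG n (tensorModule n l X) :=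
  X.isInO.isNMinusFG.tensorPower l

theorem tensorMap_injective (l : ℕ) {X Y : CategoryO.{u} n} (f : X ⟶ Y)
    (hf : Function.Injective (CategoryO.toLie f)) : Function.Injective (tensorMap l f) :=
  Module.Flat.rTensor_preserves_injective_linearMap (M := ⨂[ℂ]^l (Fin n → ℂ))
    (CategoryO.toLie f : X →ₗ[ℂ] Y) hf

theorem tensorMap_surjective (l : ℕ) {X Y : CategoryO.{u} n} (f : X ⟶ Y)
    (hf : Function.Surjective (CategoryO.toLie f)) : Function.Surjective (tensorMap l f) :=
  LinearMap.rTensor_surjective (⨂[ℂ]^l (Fin n → ℂ)) (g := (CategoryO.toLie f : X →ₗ[ℂ] Y)) hf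

theorem tensorMap_exact (l : ℕ) {X Y Z : CategoryO.{u} n} (f : X ⟶ Y) (g : Y ⟶ Z)
    (hfg : Function.Exact (CategoryO.toLie f) (CategoryO.toLie g))
    (hg : Function.Surjective (CategoryO.toLie g)) :
    Function.Exact (tensorMap l f) (tensorMap l g) :=
  rTensor_exact (⨂[ℂ]^l (Fin n → ℂ)) (f := (CategoryO.toLie f : X →ₗ[ℂ] Y))
    (g := (CategoryO.toLie g : Y →ₗ[ℂ] Z)) hfg hg

theorem tensorMap_add (l : ℕ) {X Y : CategoryO.{u} n} (f g : X ⟶ Y) (m : tensorModule n l X) :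
    tensorMap l (f + g) m = tensorMap l f m + tensorMap l g m :=
  LinearMap.congr_fun (TensorProduct.map_add_left (CategoryO.toLie f : X →ₗ[ℂ] Y)
    (CategoryO.toLie g : X →ₗ[ℂ] Y) (LinearMap.id (M := ⨂[ℂ]^l (Fin n → ℂ)))) m

theorem H0weightMap_tensorMap_add (l : ℕ) (wt : Weight n) {X Y : CategoryO.{u} n} (f g : X ⟶ Y) :
    H0weightMap wt (tensorMap l (f + g)) =
      H0weightMap wt (tensorMap l f) + H0weightMap wt (tensorMap l g) := by
  apply LinearMap.ext
  rintro ⟨v, hv⟩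
  obtain ⟨m, rfl⟩ := LieSubmodule.Quotient.surjective_mk' _ v
  apply Subtype.ext
  change LieSubmodule.Quotient.mk (tensorMap l (f + g) m) =
    LieSubmodule.Quotient.mk (tensorMap l f m + tensorMap l g m)
  rw [tensorMap_add]

/-- The functor `F_wt` with values in finite-dimensional vector spaces. -/
def finiteF (n l : ℕ) (wt : Weight n) : CategoryO.{u} n ⥤ FGModuleCat.{u} ℂ :=
  (ModuleCat.isFG ℂ).lift (F n l wt) fun X =>
    (X.isNMinusFG_tensorModule l).finite_weightSpace_H0 wt

end Functor

end TypeA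

end

theorem mainTheorem1 (n l : ℕ) (hn : 1 ≤ n) (hl : 1 ≤ l) (wt : TypeA.Weight n)
    (hwt : TypeA.IsDominantIntegral (wt + TypeA.rho n)) :
    ∃ G : TypeA.CategoryO.{u} n ⥤ FGModuleCat.{u} ℂ,
      G ⋙ forget₂ (FGModuleCat.{u} ℂ) (ModuleCat.{u} ℂ) = TypeA.F n l wt ∧
      G.Additive ∧
      ∀ (X Y Z : TypeA.CategoryO.{u} n) (f : X ⟶ Y) (g : Y ⟶ Z), TypeA.IsShortExact f g →
        Function.Injective (G.map f).hom.hom ∧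
        Function.Exact (G.map f).hom.hom (G.map g).hom.hom ∧
        Function.Surjective (G.map g).hom.hom := by
  refine ⟨TypeA.finiteF n l wt, rfl, ⟨fun {X Y f g} => ?_⟩, fun X Y Z f g ⟨hf, hfg, hg⟩ => ?_⟩
  · exact FGModuleCat.hom_ext (TypeA.H0weightMap_tensorMap_add l wt f g)
  · have hX := X.isNMinusFG_tensorModule l
    have hY := Y.isNMinusFG_tensorModule l
    have hZ := Z.isNMinusFG_tensorModule l
    exact ⟨TypeA.H0weightMap_injective hX hY hwt _ (TypeA.tensorMap_injective l f hf),
      TypeA.H0weightMap_exact hX hY wt _ _ (TypeA.tensorMap_exact l f g hfg hg)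
        (TypeA.tensorMap_surjective l g hg),
      TypeA.H0weightMap_surjective hY hZ wt _ (TypeA.tensorMap_surjective l g hg)⟩
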